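/- Let $q\ge 2$ and $d\ge 1$ be integers and $A_0,\dots,A_{q-1}\in\mathbb{C}^{d\times d}$. Let $f$ be the sequence of $d\times d$ matrices with $f(0)=I$ and $f(qn+r)=A_r f(n)$ for $0\le r<q$, $n\ge 0$, $qn+r\ne 0$, and let $F(N)=\sum_{0\le n<N} f(n)$ and $C=\sum_{0\le r<q}A_r$. Fix a norm $\|\cdot\|$ on $\mathbb{C}^d$ together with its induced matrix norm (vectors are row vectors, $x\mapsto xM$). For $\ell\ge 1$ put $\rho_\ell=\sup\{\|A_{r_1}\cdots A_{r_\ell}\|^{1/\ell} : r_1,\dots,r_\ell\in\{0,\dots,q-1\}\}$, and let $\rho=\inf_{\ell\ge1}\rho_\ell$ be the joint spectral radius. If $\rho=\rho_\ell$ for some $\ell\ge 1$, let $R=\rho$; otherwise let $R>\rho$ be any number such that $C$ has no eigenvalue $\lambda$ with $\rho<|\lambda|\le R$. Let $T$ be an invertible matrix such that $J=TCT^{-1}$ is in Jordan form, and let $D$ be the diagonal matrix whose $j$th diagonal element is $0$ if that of $J$ equals $1$, and is $1$ otherwise. Put $C'=T^{-1}DJT$, $K=T^{-1}DT(I-C')^{-1}(I-A_0)$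 and, for $m\ge 1$, $\vartheta_m=\frac1{m!}T^{-1}(I-D)T(C-I)^{m-1}(I-A_0)$. Let $w$ be a generalised left eigenvector of rank $m\ge 1$ of $C$ for the eigenvalue $\lambda$, i.e. $w(C-\lambda I)^m=0$ and $w(C-\lambda I)^{m-1}\neq 0$. Here $\log_q\lambda=\log\lambda/\log q$ with the principal logarithm, $\{x\}$ is the fractional part of $x$, and if $R=0$, then $N^{\log_q R}$ is read as $0$. 1. If $|\lambda|<R$, then, as $N\to\infty$, $wF(N)=wK+(\log_q N)^m w\vartheta_m+O(\|w\|\,N^{\log_q R})$. 2. If $|\lambda|=R$, then, as $N\to\infty$, $wF(N)=wK+(\log_q N)^m w\vartheta_m+O(\|w\|\,N^{\log_q R}(\log N)^m)$. 3. If $|\lambda|>R$, then there are $1$-periodic continuous functions $\Phi_k\colon\mathbb{R}\to\mathbb{C}^d$, $0\le k<m$, such that $$wF(N)=wK+(\log_q N)^m w\vartheta_m+N^{\log_q\lambda}\sum_{0\le k<m}(\log_q N)^k\,\Phi_k(\{\log_q N\})$$ for all integers $N\ge q^{m-1}$. Each $\Phi_k$ is Hölder continuous with any positive exponent smaller than $\log_q(|\lambda|/R)$.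 If, additionally, $w(C-\lambda I)^{m-1}$ is a left eigenvector of each of $A_0,\dots,A_{q-1}$ for the eigenvalue $1$, then $\Phi_{m-1}$ is constant: for all $u\in\mathbb{R}$, $\Phi_{m-1}(u)=\frac{1}{q^{m-1}(m-1)!}\,w(C-qI)^{m-1}$. The implicit $O$-constants, and the bounds from which on the estimates hold, depend only on $q$, $d$, $A_0,\dots,A_{q-1}$, the norm and $R$ (not on $T$, $\lambda$, $m$, $w$). Moreover, $wK=0$ if $\lambda=1$, and $w\vartheta_m=0$ if $\lambda\ne 1$. -/

import Mathlib

open Matrix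

noncomputable section

namespace MatrixProducts

variable {q d : ℕ}

/-- The sequence `f` of `d × d` matrices with `f(0) = I` and
`f(qn + r) = A_r f(n)` whenever `0 ≤ r < q` and `qn + r ≠ 0`
(see `seqF_zero` and `seqF_mul_add`). -/
def seqF (hq : 2 ≤ q) (A : Fin q → Matrix (Fin d) (Fin d) ℂ) (n : ℕ) :
    Matrix (Fin d) (Fin d) ℂ :=
  if h : n = 0 then 1
  else A ⟨n % q, Nat.mod_lt n (by omega)⟩ * seqF hq A (n / q)
termination_by n
decreasing_by exact Nat.div_lt_self (by omega) (by omega)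

theorem seqF_zero (hq : 2 ≤ q) (A : Fin q → Matrix (Fin d) (Fin d) ℂ) :
    seqF hq A 0 = 1 := by
  rw [seqF, dif_pos rfl]

theorem seqF_mul_add (hq : 2 ≤ q) (A : Fin q → Matrix (Fin d) (Fin d) ℂ) (n : ℕ) (r : Fin q)
    (h : q * n + r ≠ 0) : seqF hq A (q * n + r) = A r * seqF hq A n := by
  have h1 : (q * n + (r : ℕ)) % q = r := by
    rw [Nat.mul_add_mod, Nat.mod_eq_of_lt r.isLt]
  have h2 : (q * n + (r : ℕ)) / q = n := by
    rw [Nat.mul_add_div (by omega), Nat.div_eq_of_lt r.isLt, add_zero]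
  rw [seqF, dif_neg h, h2]
  congr 2
  exact Fin.ext h1

/-- The summatory function `F(N) = ∑_{0 ≤ n < N} f(n)`. -/
def sumF (hq : 2 ≤ q) (A : Fin q → Matrix (Fin d) (Fin d) ℂ) (N : ℕ) :
    Matrix (Fin d) (Fin d) ℂ :=
  ∑ n ∈ Finset.range N, seqF hq A n

/-- `C = ∑_{0 ≤ r < q} A_r`. -/
def matC (A : Fin q → Matrix (Fin d) (Fin d) ℂ) : Matrix (Fin d) (Fin d) ℂ :=
  ∑ r, A r

/-- The matrix norm induced by a norm `ν` on (row) vectors. -/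
def inducedNorm (ν : Seminorm ℂ (Fin d → ℂ)) (M : Matrix (Fin d) (Fin d) ℂ) : ℝ :=
  sInf {c : ℝ | 0 ≤ c ∧ ∀ x : Fin d → ℂ, ν (x ᵥ* M) ≤ c * ν x}

/-- `ρ_ℓ = sup { ‖A_{r_1} ⋯ A_{r_ℓ}‖^{1/ℓ} | r_1, …, r_ℓ ∈ {0, …, q-1} }`, for `ℓ ≥ 1`. -/
def rhoAt (ν : Seminorm ℂ (Fin d → ℂ)) (A : Fin q → Matrix (Fin d) (Fin d) ℂ) (ℓ : ℕ) : ℝ :=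
  ⨆ r : Fin ℓ → Fin q,
    inducedNorm ν (List.ofFn fun i => A (r i)).prod ^ ((1 : ℝ) / (ℓ : ℝ))

/-- The joint spectral radius `ρ = inf_{ℓ ≥ 1} ρ_ℓ`. -/
def jointSpectralRadius (ν : Seminorm ℂ (Fin d → ℂ))
    (A : Fin q → Matrix (Fin d) (Fin d) ℂ) : ℝ :=
  ⨅ ℓ : ℕ+, rhoAt ν A ℓ

/-- The finiteness property: `ρ = ρ_ℓ` for some `ℓ ≥ 1`. -/
def FinitenessProperty (ν : Seminorm ℂ (Fin d → ℂ))
    (A : Fin q → Matrix (Fin d) (Fin d) ℂ) : Prop :=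
  ∃ ℓ : ℕ, 0 < ℓ ∧ jointSpectralRadius ν A = rhoAt ν A ℓ

/-- The admissible choices of `R`: it is `ρ` if the finiteness property holds; otherwise it is
any number `> ρ` such that no eigenvalue `lam` of `C` has `ρ < |lam| ≤ R`. -/
def IsAdmissibleRadius (ν : Seminorm ℂ (Fin d → ℂ))
    (A : Fin q → Matrix (Fin d) (Fin d) ℂ) (R : ℝ) : Prop :=
  (FinitenessProperty ν A → R = jointSpectralRadius ν A) ∧
  (¬ FinitenessProperty ν A → jointSpectralRadius ν A < R ∧
    ∀ lam ∈ spectrum ℂ (matC A), ¬ (jointSpectralRadius ν A < ‖lam‖ ∧ ‖lam‖ ≤ R))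

/-- `J` is in Jordan form: only the diagonal and the superdiagonal can be nonzero, the
superdiagonal entries are `0` or `1`, and a `1` there joins two equal diagonal entries. -/
structure IsJordanForm (J : Matrix (Fin d) (Fin d) ℂ) : Prop where
  off_diag : ∀ i j : Fin d, (j : ℕ) ≠ i → (j : ℕ) ≠ i + 1 → J i j = 0
  super_diag : ∀ i j : Fin d, (j : ℕ) = i + 1 → J i j = 0 ∨ (J i j = 1 ∧ J i i = J j j)

/-- The Jordan form `J = T C T⁻¹`. -/
def matJ (A : Fin q → Matrix (Fin d) (Fin d) ℂ) (T : Matrix (Fin d) (Fin d) ℂ) :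
    Matrix (Fin d) (Fin d) ℂ :=
  T * matC A * T⁻¹

open Classical in
/-- The diagonal matrix `D` whose `j`-th diagonal entry is `0` if that of `J` is `1`, and is `1`
otherwise. -/
def matD (A : Fin q → Matrix (Fin d) (Fin d) ℂ) (T : Matrix (Fin d) (Fin d) ℂ) :
    Matrix (Fin d) (Fin d) ℂ :=
  Matrix.diagonal fun j => if matJ A T j j = 1 then 0 else 1

/-- `C' = T⁻¹ D J T`. -/
def matC' (A : Fin q → Matrix (Fin d) (Fin d) ℂ) (T : Matrix (Fin d) (Fin d) ℂ) :
    Matrix (Fin d) (Fin d) ℂ :=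
  T⁻¹ * matD A T * matJ A T * T

/-- The matrix `A_0`. -/
def matA0 (hq : 2 ≤ q) (A : Fin q → Matrix (Fin d) (Fin d) ℂ) : Matrix (Fin d) (Fin d) ℂ :=
  A ⟨0, by omega⟩

/-- `K = T⁻¹ D T (I - C')⁻¹ (I - A_0)`. -/
def matK (hq : 2 ≤ q) (A : Fin q → Matrix (Fin d) (Fin d) ℂ)
    (T : Matrix (Fin d) (Fin d) ℂ) : Matrix (Fin d) (Fin d) ℂ :=
  T⁻¹ * matD A T * T * (1 - matC' A T)⁻¹ * (1 - matA0 hq A)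

/-- `ϑ_m = (1 / m!) T⁻¹ (I - D) T (C - I)^{m-1} (I - A_0)`, for `m ≥ 1`. -/
def theta (hq : 2 ≤ q) (A : Fin q → Matrix (Fin d) (Fin d) ℂ)
    (T : Matrix (Fin d) (Fin d) ℂ) (m : ℕ) : Matrix (Fin d) (Fin d) ℂ :=
  ((m.factorial : ℂ)⁻¹) •
    (T⁻¹ * (1 - matD A T) * T * (matC A - 1) ^ (m - 1) * (1 - matA0 hq A))

/-- `w` is a generalised left eigenvector of rank `m ≥ 1` of `M` for the eigenvalue `lam`:
`w (M - lam I)^m = 0` and `w (M - lam I)^{m-1} ≠ 0`. -/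
structure IsGenLeftEigenvector (M : Matrix (Fin d) (Fin d) ℂ) (lam : ℂ) (m : ℕ)
    (w : Fin d → ℂ) : Prop where
  one_le : 1 ≤ m
  vecMul_pow : w ᵥ* (M - lam • (1 : Matrix (Fin d) (Fin d) ℂ)) ^ m = 0
  vecMul_pow_pred : w ᵥ* (M - lam • (1 : Matrix (Fin d) (Fin d) ℂ)) ^ (m - 1) ≠ 0

/-- The growth rate `N^{log_q R}` for `R > 0`. For `R = 0` it is `0`, so that an error term
`O(N^{log_q R})` is one that vanishes for all large `N`. -/
def rate (q : ℕ) (R : ℝ) (N : ℕ) : ℝ :=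
  if R = 0 then 0 else (N : ℝ) ^ Real.logb q R

/-- `N^{log_q lam}` for complex `lam ≠ 0`, where `log_q lam = log lam / log q` with the principal
logarithm. -/
def cpowLog (q : ℕ) (lam : ℂ) (N : ℕ) : ℂ :=
  (N : ℂ) ^ (Complex.log lam / Complex.log q)

/-- The explicit terms `w K + (log_q N)^m w ϑ_m`. -/
def mainTerm (hq : 2 ≤ q) (A : Fin q → Matrix (Fin d) (Fin d) ℂ)
    (T : Matrix (Fin d) (Fin d) ℂ) (m : ℕ) (w : Fin d → ℂ) (N : ℕ) : Fin d → ℂ :=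
  w ᵥ* matK hq A T + ((Real.logb q N : ℂ) ^ m) • (w ᵥ* theta hq A T m)

end MatrixProducts

end

/-! Grouping summands by their last base-`q` digit gives F(qN) = C F(N) + (I - A_0) for N ≥ 1
(`sumF_mul`), and admissibility of R gives f(N) = O(R^⌊log_q N⌋), with f(N) = 0 eventually if R = 0
(`productsBounded_of_isAdmissibleRadius`). So wF is governed by C along the Jordan chain V_k = w(C -
λ)^k, up to perturbations of rate R and the inhomogeneity I - A_0. For λ ≠ 1 the latter is absorbed
by subtracting wK, because wK = wCK + w(I - A_0). For λ = 1 it acts as one more member of the chain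
and produces the term (log_q N)^m wϑ_m.

If |λ| ≤ R, unrolling the recursion over the ℓ + 1 digits of N bounds the error by a multiple of ∑_j
‖wC^j‖ R^(ℓ-j) (`norm_vecMul_le_sum_of_recurrence`). This sum is geometric for |λ| < R and gains a
factor of order ℓ^m for |λ| = R. If R = 0, the recursion is eventually exact and d steps of it
annihilate w.

If |λ| > R, the corrected chain is a vector X(N) with X(qN) = λ(1 + a) X(N), where a is a nilpotent
shift. Let T(t) = (λ(1 + a))^t. Since X has increments of rate R and T(-t) decays like μ^(-t) for
any μ strictly between R and |λ|, T(-(u+n)) X(⌊q^(u+n)⌋) converges geometrically to a 1-periodic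
Ψ(u). At u = log_q N the sequence is constant, so X(N) = T(log_q N) Ψ(log_q N)
(`IsSelfSimilar.exists_periodic`). Expanding T in powers of t yields the Φ_k. The top one involves
only the last coordinate of Ψ, which is explicit in the two cases needed.

Constants are uniform in T because wK (λ ≠ 1) and wϑ_m (λ = 1) do not depend on T, in m because m ≤
d, and in λ because the spectrum is finite. -/

open Matrix Filter Topology

noncomputable section

/-! ### Powers of nilpotent perturbations of scalars -/

/-- The truncated binomial series `∑_{k < M} (t choose k) a ^ k`, that is `(1 + a) ^ t` when
`a ^ M = 0`. -/
def unipotentPow {𝔸 : Type*} [Ring 𝔸] [Algebra ℂ 𝔸] (a : 𝔸) (M : ℕ) (t : ℂ) : 𝔸 :=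
  ∑ k ∈ Finset.range M, Ring.choose t k • a ^ k

/-- Vandermonde's identity for `Ring.choose`, applied along the diagonals i + j = n; pairs with i +
j ≥ M drop out because a ^ M = 0. -/
theorem unipotentPow_add {𝔸 : Type*} [Ring 𝔸] [Algebra ℂ 𝔸] {a : 𝔸} {M : ℕ} (ha : a ^ M = 0)
    (s t : ℂ) : unipotentPow a M (s + t) = unipotentPow a M s * unipotentPow a M t := by
  have h1 : unipotentPow a M s * unipotentPow a M t =
      ∑ i ∈ Finset.range M, ∑ j ∈ Finset.range (M - i),
        (Ring.choose s i * Ring.choose t j) • a ^ (i + j) := by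
    rw [unipotentPow, unipotentPow, Finset.sum_mul_sum]
    refine Finset.sum_congr rfl fun i _ => ?_
    rw [← Finset.sum_subset (Finset.range_mono (Nat.sub_le M i))]
    · refine Finset.sum_congr rfl fun j _ => ?_
      rw [smul_mul_smul_comm, pow_add]
    · intro j _ hj
      rw [Finset.mem_range, not_lt] at hj
      rw [smul_mul_smul_comm, ← pow_add, pow_eq_zero_of_le (by omega) ha, smul_zero]
  rw [h1, ← Finset.sum_range_diag_flip M
    (fun i j => (Ring.choose s i * Ring.choose t j) • a ^ (i + j)), unipotentPow]
  refine Finset.sum_congr rfl fun n _ => ?_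
  rw [Ring.add_choose_eq n (Commute.all s t), Finset.sum_smul,
    Finset.Nat.sum_antidiagonal_eq_sum_range_succ_mk]
  refine Finset.sum_congr rfl fun i hi => ?_
  rw [Finset.mem_range] at hi
  rw [show i + (n - i) = n by omega]

theorem unipotentPow_zero {𝔸 : Type*} [Ring 𝔸] [Algebra ℂ 𝔸] (a : 𝔸) {M : ℕ} (hM : 0 < M) :
    unipotentPow a M 0 = 1 := by
  rw [unipotentPow, Finset.sum_eq_single_of_mem 0 (by simpa using hM)]
  · simp
  · intro k _ hk
    rw [Ring.choose_zero_pos ℂ (Nat.pos_of_ne_zero hk), zero_smul]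

theorem unipotentPow_one {𝔸 : Type*} [Ring 𝔸] [Algebra ℂ 𝔸] {a : 𝔸} {M : ℕ} (hM : 0 < M)
    (ha : a ^ M = 0) : unipotentPow a M 1 = 1 + a := by
  have hc : ∀ k : ℕ, Ring.choose (1 : ℂ) k = (Nat.choose 1 k : ℂ) := fun k => by
    simpa using Ring.choose_natCast (R := ℂ) 1 k
  obtain rfl | hM2 : M = 1 ∨ 2 ≤ M := by omega
  · rw [pow_one] at ha
    simp [unipotentPow, ha]
  · rw [unipotentPow, ← Finset.sum_subset (Finset.range_mono hM2)]
    · simp [Finset.sum_range_succ, hc]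
    · intro k _ hk
      rw [Finset.mem_range, not_lt] at hk
      rw [hc, Nat.choose_eq_zero_of_lt (by omega), Nat.cast_zero, zero_smul]

theorem choose_eq_sum_pow (t : ℂ) {k M : ℕ} (hk : k < M) :
    Ring.choose t k =
      ∑ i ∈ Finset.range M, ((k.factorial : ℂ)⁻¹ * (descPochhammer ℂ k).coeff i) * t ^ i := by
  have h := Polynomial.eval_eq_sum_range' (p := descPochhammer ℂ k) (n := M)
    (by rwa [descPochhammer_natDegree]) t
  rw [Ring.choose_eq_smul, ← Polynomial.aeval_eq_smeval, ← descPochhammer_map (Int.castRingHom ℂ),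
    Polynomial.aeval_def, Polynomial.eval₂_eq_eval_map] at *
  rw [show algebraMap ℤ ℂ = Int.castRingHom ℂ from rfl, h, Finset.smul_sum]
  refine Finset.sum_congr rfl fun i _ => ?_
  rw [smul_eq_mul, mul_assoc]

/-- The coefficient of `t ^ i` in `unipotentPow a M t`. -/
def unipotentCoeff {𝔸 : Type*} [Ring 𝔸] [Algebra ℂ 𝔸] (a : 𝔸) (M i : ℕ) : 𝔸 :=
  ∑ k ∈ Finset.range M, ((k.factorial : ℂ)⁻¹ * (descPochhammer ℂ k).coeff i) • a ^ k

theorem unipotentPow_eq_sum {𝔸 : Type*} [Ring 𝔸] [Algebra ℂ 𝔸] (a : 𝔸) (M : ℕ) (t : ℂ) :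
    unipotentPow a M t = ∑ i ∈ Finset.range M, t ^ i • unipotentCoeff a M i := by
  simp_rw [unipotentCoeff, Finset.smul_sum]
  rw [Finset.sum_comm, unipotentPow]
  refine Finset.sum_congr rfl fun k hk => ?_
  rw [choose_eq_sum_pow t (Finset.mem_range.mp hk), Finset.sum_smul]
  refine Finset.sum_congr rfl fun i _ => ?_
  rw [smul_smul, mul_comm]

/-- Only the summand k = n reaches degree n, and the falling factorial is monic. For a shift, a ^ n
sees the last coordinate only, which makes the top periodic function computable. -/
theorem unipotentCoeff_top {𝔸 : Type*} [Ring 𝔸] [Algebra ℂ 𝔸] (a : 𝔸) (n : ℕ) :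
    unipotentCoeff a (n + 1) n = (n.factorial : ℂ)⁻¹ • a ^ n := by
  rw [unipotentCoeff, Finset.sum_eq_single_of_mem n (by simp)]
  · have h := (monic_descPochhammer ℂ n).coeff_natDegree
    rw [descPochhammer_natDegree] at h
    rw [h, mul_one]
  · intro k hk hkn
    rw [Finset.mem_range] at hk
    rw [Polynomial.coeff_eq_zero_of_natDegree_lt (by rw [descPochhammer_natDegree]; omega),
      mul_zero, zero_smul]

theorem pow_le_mul_exp (k : ℕ) {ε t : ℝ} (hε : 0 < ε) (ht : 0 ≤ t) :
    t ^ k ≤ (k.factorial / ε ^ k) * Real.exp (ε * t) := by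
  have h := Real.pow_div_factorial_le_exp (ε * t) (by positivity) k
  have hk : (0 : ℝ) < k.factorial := by positivity
  rw [div_le_iff₀ hk, mul_pow] at h
  rw [div_mul_eq_mul_div, le_div_iff₀ (by positivity)]
  linarith

/-- The one-parameter group `t ↦ (lam (1 + a)) ^ t` for nilpotent `a`. -/
def jordanPow {𝔸 : Type*} [Ring 𝔸] [Algebra ℂ 𝔸] (lam : ℂ) (a : 𝔸) (M : ℕ) (t : ℝ) : 𝔸 :=
  Complex.exp (t * Complex.log lam) • unipotentPow a M t

section jordanPow

variable {𝔸 : Type*} [Ring 𝔸] [Algebra ℂ 𝔸] {lam : ℂ} {a : 𝔸} {M : ℕ}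

theorem jordanPow_add (ha : a ^ M = 0) (s t : ℝ) :
    jordanPow lam a M (s + t) = jordanPow lam a M s * jordanPow lam a M t := by
  rw [jordanPow, jordanPow, jordanPow, smul_mul_smul_comm, ← unipotentPow_add ha, ← Complex.exp_add]
  push_cast
  ring_nf

theorem jordanPow_zero (hM : 0 < M) : jordanPow lam a M 0 = 1 := by
  simp [jordanPow, unipotentPow_zero a hM]

theorem jordanPow_one (hlam : lam ≠ 0) (hM : 0 < M) (ha : a ^ M = 0) :
    jordanPow lam a M 1 = lam • (1 + a) := by
  simp [jordanPow, unipotentPow_one hM ha, Complex.exp_log hlam]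

end jordanPow

theorem norm_exp_mul_log {lam : ℂ} (hlam : lam ≠ 0) (t : ℝ) :
    ‖Complex.exp (t * Complex.log lam)‖ = ‖lam‖ ^ t := by
  rw [Complex.norm_exp, Complex.re_ofReal_mul, Complex.log_re,
    Real.rpow_def_of_pos (norm_pos_iff.mpr hlam), mul_comm]

/-- The group decays like ‖lam‖^(-t) times a polynomial in t. The polynomial is absorbed by exp(εt)
= (‖lam‖/μ)^t, which turns ‖lam‖^(-t) into μ^(-t). -/
theorem exists_norm_jordanPow_neg_le {𝔸 : Type*} [NormedRing 𝔸] [NormedAlgebra ℂ 𝔸] {lam : ℂ}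
    (a : 𝔸) (M : ℕ) {μ : ℝ} (hμ : 0 < μ) (hlam : μ < ‖lam‖) :
    ∃ c, 0 ≤ c ∧ ∀ t : ℝ, 0 ≤ t → ‖jordanPow lam a M (-t)‖ ≤ c * μ ^ (-t) := by
  have hl0 : lam ≠ 0 := by
    rintro rfl
    rw [norm_zero] at hlam
    linarith
  set ε := Real.log (‖lam‖ / μ) with hε
  have hεpos : 0 < ε := Real.log_pos (by rwa [one_lt_div hμ])
  refine ⟨∑ i ∈ Finset.range M, (i.factorial / ε ^ i) * ‖unipotentCoeff a M i‖,
    Finset.sum_nonneg fun i _ => by positivity, fun t ht => ?_⟩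
  have hexp : Real.exp (ε * t) = (‖lam‖ / μ) ^ t := by
    rw [hε, Real.rpow_def_of_pos (by positivity)]
  have h1 : ‖unipotentPow a M ((-t : ℝ) : ℂ)‖ ≤
      (∑ i ∈ Finset.range M, (i.factorial / ε ^ i) * ‖unipotentCoeff a M i‖) *
        (‖lam‖ / μ) ^ t := by
    rw [unipotentPow_eq_sum, Finset.sum_mul]
    refine (norm_sum_le _ _).trans (Finset.sum_le_sum fun i _ => ?_)
    rw [norm_smul, norm_pow, Complex.norm_real, norm_neg, Real.norm_of_nonneg ht]
    have := pow_le_mul_exp i hεpos ht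
    rw [hexp] at this
    calc t ^ i * ‖unipotentCoeff a M i‖
        ≤ ((i.factorial / ε ^ i) * (‖lam‖ / μ) ^ t) * ‖unipotentCoeff a M i‖ := by gcongr
      _ = _ := by ring
  rw [jordanPow, norm_smul, norm_exp_mul_log hl0]
  have hlpos : 0 < ‖lam‖ := norm_pos_iff.mpr hl0
  set S := ∑ i ∈ Finset.range M, (i.factorial / ε ^ i) * ‖unipotentCoeff a M i‖
  calc _ ≤ ‖lam‖ ^ (-t) * (S * (‖lam‖ / μ) ^ t) := by gcongr
    _ = S * (‖lam‖ ^ (-t) * (‖lam‖ / μ) ^ t) := by ring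
    _ = _ := by
      congr 1
      rw [Real.div_rpow hlpos.le hμ.le, Real.rpow_neg hlpos.le, Real.rpow_neg hμ.le]
      have : ‖lam‖ ^ t ≠ 0 := (Real.rpow_pos_of_pos hlpos t).ne'
      field_simp

theorem exists_norm_jordanPow_sub_one_le {𝔸 : Type*} [NormedRing 𝔸] [NormedAlgebra ℂ 𝔸] (lam : ℂ)
    (a : 𝔸) {M : ℕ} (hM : 0 < M) (B : ℝ) :
    ∃ L, 0 ≤ L ∧ ∀ h : ℝ, |h| ≤ B → ‖jordanPow lam a M h - 1‖ ≤ L * |h| := by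
  have hsm : ContDiff ℝ 1 (jordanPow lam a M) := by
    have h1 : ContDiff ℝ 1 fun t : ℝ => (t : ℂ) := Complex.ofRealCLM.contDiff
    have : jordanPow lam a M = fun t : ℝ => Complex.exp (t * Complex.log lam) •
        ∑ i ∈ Finset.range M, (t : ℂ) ^ i • unipotentCoeff a M i := by
      funext t
      rw [jordanPow, unipotentPow_eq_sum]
    rw [this]
    refine ContDiff.smul (h1.mul contDiff_const).cexp (ContDiff.sum fun i _ => ?_)
    exact (h1.pow i).smul contDiff_const
  obtain ⟨L, hL⟩ := (hsm.locallyLipschitz.locallyLipschitzOn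
    (s := Metric.closedBall 0 |B|)).exists_lipschitzOnWith_of_compact (isCompact_closedBall 0 |B|)
  refine ⟨L, L.2, fun h hh => ?_⟩
  have := hL.dist_le_mul h (by simpa using hh.trans (le_abs_self B)) 0 (by simp)
  rwa [jordanPow_zero hM, dist_eq_norm, dist_zero_right, Real.norm_eq_abs] at this

/-! ### Rescaled limits of self-similar sequences -/

/-- Below q^(n+3) and from q^n on, ⌊log_q⌋ is n, n + 1 or n + 2, so each increment costs at most c
max(1,R)^3 R^n. This window contains ⌊q^(u+n)⌋ for all u in [0,2]. -/
theorem norm_sub_le_of_norm_succ_sub_le {E : Type*} [NormedAddCommGroup E] {q : ℕ} {X : ℕ → E}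
    {c R : ℝ} (hq : 2 ≤ q) (hR : 0 < R) (hc : 0 ≤ c)
    (hX : ∀ N, 1 ≤ N → ‖X (N + 1) - X N‖ ≤ c * R ^ Nat.log q N) {n a b : ℕ} (ha : q ^ n ≤ a)
    (hab : a ≤ b) (hb : b ≤ q ^ (n + 3)) :
    ‖X b - X a‖ ≤ c * (max 1 R) ^ 3 * R ^ n * ((b : ℝ) - a) := by
  induction b, hab using Nat.le_induction with
  | base => simp
  | succ b hab ih =>
    have h1 := ih (by omega)
    have hb0 : b ≠ 0 := by
      have : 0 < q ^ n := by positivity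
      omega
    have h2 : n ≤ Nat.log q b := Nat.le_log_of_pow_le (by omega) (ha.trans hab)
    have h3 : Nat.log q b < n + 3 := Nat.log_lt_of_lt_pow hb0 (by omega)
    have h4 : R ^ Nat.log q b ≤ (max 1 R) ^ 3 * R ^ n := by
      obtain ⟨k, hk⟩ := Nat.exists_eq_add_of_le h2
      rw [hk, pow_add, mul_comm]
      gcongr
      calc R ^ k ≤ (max 1 R) ^ k := by gcongr; exact le_max_right _ _
        _ ≤ (max 1 R) ^ 3 := pow_le_pow_right₀ (le_max_left _ _) (by omega)
    have h5 := hX b (by omega)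
    calc ‖X (b + 1) - X a‖ = ‖(X (b + 1) - X b) + (X b - X a)‖ := by congr 1; abel
      _ ≤ ‖X (b + 1) - X b‖ + ‖X b - X a‖ := norm_add_le _ _
      _ ≤ c * ((max 1 R) ^ 3 * R ^ n) + c * (max 1 R) ^ 3 * R ^ n * ((b : ℝ) - a) := by
        gcongr
        exact h5.trans (by gcongr)
      _ = _ := by push_cast; ring

theorem rpow_neg_le_of_mem_Icc {μ u : ℝ} (hμ : 0 < μ) (hu : u ∈ Set.Icc (0 : ℝ) 2) :
    μ ^ (-u) ≤ 1 + μ ^ (-2 : ℝ) := by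
  have h2 : 0 < μ ^ (-2 : ℝ) := by positivity
  rcases le_total 1 μ with h | h
  · have := Real.rpow_le_one_of_one_le_of_nonpos h (neg_nonpos.mpr hu.1)
    linarith
  · have := Real.rpow_le_rpow_of_exponent_ge hμ h (neg_le_neg hu.2)
    linarith

theorem le_floor_rpow {q : ℕ} (hq : 2 ≤ q) {u : ℝ} (hu : 0 ≤ u) (n : ℕ) :
    q ^ n ≤ ⌊(q : ℝ) ^ (u + n)⌋₊ := by
  have hq1 : (1 : ℝ) ≤ q := by exact_mod_cast (by omega : 1 ≤ q)
  apply Nat.le_floor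
  push_cast
  rw [← Real.rpow_natCast]
  exact Real.rpow_le_rpow_of_exponent_le hq1 (by linarith)

theorem floor_rpow_le {q : ℕ} (hq : 2 ≤ q) {u : ℝ} (n m : ℕ) (hu : u ≤ m) :
    ⌊(q : ℝ) ^ (u + n)⌋₊ ≤ q ^ (n + m) := by
  have hq1 : (1 : ℝ) ≤ q := by exact_mod_cast (by omega : 1 ≤ q)
  apply Nat.floor_le_of_le
  push_cast
  rw [← Real.rpow_natCast]
  push_cast
  exact Real.rpow_le_rpow_of_exponent_le hq1 (by linarith)

section Periodic

variable {E : Type*} [NormedAddCommGroup E] [NormedSpace ℂ E]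

/-- The rescaled sequence `T (-(u + n)) X(⌊q ^ (u + n)⌋)`. -/
def scaledSeq (q : ℕ) (T : ℝ → E →L[ℂ] E) (X : ℕ → E) (u : ℝ) (n : ℕ) : E :=
  T (-(u + n)) (X ⌊(q : ℝ) ^ (u + n)⌋₊)

variable {q : ℕ} {T : ℝ → E →L[ℂ] E} {X : ℕ → E} {R : ℝ}

theorem norm_apply_neg_le {cT μ : ℝ} (hμ : 0 < μ) (hcT : 0 ≤ cT)
    (hT : ∀ t : ℝ, 0 ≤ t → ‖T (-t)‖ ≤ cT * μ ^ (-t)) {u : ℝ} (hu : u ∈ Set.Icc (0 : ℝ) 2)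
    (n : ℕ) : ‖T (-(u + n))‖ ≤ cT * (1 + μ ^ (-2 : ℝ)) * (μ ^ n)⁻¹ := by
  have hn : (0 : ℝ) ≤ n := n.cast_nonneg
  refine (hT _ (add_nonneg hu.1 hn)).trans ?_
  rw [neg_add, Real.rpow_add hμ, Real.rpow_neg hμ.le (n : ℝ), Real.rpow_natCast, ← mul_assoc]
  gcongr
  exact rpow_neg_le_of_mem_Icc hμ hu

/-- `X` is self-similar with respect to the one-parameter group `T`, that is `X(qN) = T(1) X(N)`,
and its increments grow at most with rate `R`. -/
structure IsSelfSimilar (q : ℕ) (T : ℝ → E →L[ℂ] E) (X : ℕ → E) (R : ℝ) : Prop where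
  two_le : 2 ≤ q
  pos : 0 < R
  map_zero : T 0 = 1
  map_add : ∀ s t, T (s + t) = T s * T t
  lipschitz : ∀ B : ℝ, ∃ L, 0 ≤ L ∧ ∀ h : ℝ, |h| ≤ B → ‖T h - 1‖ ≤ L * |h|
  apply_mul : ∀ N, 1 ≤ N → X (q * N) = T 1 (X N)
  increment : ∃ c, 0 ≤ c ∧ ∀ N, 1 ≤ N → ‖X (N + 1) - X N‖ ≤ c * R ^ Nat.log q N

/-- The bound `‖T(-t)‖ = O(μ ^ (-t))` for `t ≥ 0`. -/
def HasDecay (T : ℝ → E →L[ℂ] E) (μ : ℝ) : Prop :=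
  ∃ c, 0 ≤ c ∧ ∀ t : ℝ, 0 ≤ t → ‖T (-t)‖ ≤ c * μ ^ (-t)

/-- With y = q^(u+n), self-similarity rewrites the earlier term through X(q⌊y⌋). Since ⌊qy⌋ - q⌊y⌋ ≤
q, what remains is boundedly many increments of size R^(n+1), damped by μ^(-(n+1)). -/
theorem norm_scaledSeq_succ_sub_le (h : IsSelfSimilar q T X R) {μ : ℝ} (hμ : 0 < μ)
    (hT : HasDecay T μ) :
    ∃ K, 0 ≤ K ∧ ∀ u ∈ Set.Icc (0 : ℝ) 2, ∀ n,
      ‖scaledSeq q T X u (n + 1) - scaledSeq q T X u n‖ ≤ K * (R / μ) ^ n := by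
  obtain ⟨cT, hcT, hT⟩ := hT
  obtain ⟨c, hc, hX⟩ := h.increment
  have hq := h.two_le
  have hR := h.pos
  refine ⟨cT * (1 + μ ^ (-2 : ℝ)) * (c * (max 1 R) ^ 3 * q) * (R / μ), by positivity,
    fun u hu n => ?_⟩
  have hq0 : (0 : ℝ) < q := by exact_mod_cast (by omega : 0 < q)
  set y : ℝ := (q : ℝ) ^ (u + n) with hy
  have hypos : 0 < y := by positivity
  have hk : q ^ n ≤ ⌊y⌋₊ := le_floor_rpow hq hu.1 n
  have hk1 : 1 ≤ ⌊y⌋₊ := le_trans (Nat.one_le_pow _ _ (by omega)) hk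
  have hy1 : (q : ℝ) ^ (u + ((n + 1 : ℕ) : ℝ)) = q * y := by
    push_cast
    rw [← add_assoc, Real.rpow_add_one hq0.ne', mul_comm]
  have hfl : q * ⌊y⌋₊ ≤ ⌊(q : ℝ) * y⌋₊ := by
    apply Nat.le_floor
    push_cast
    gcongr
    exact Nat.floor_le hypos.le
  have hfl2 : (⌊(q : ℝ) * y⌋₊ : ℝ) - ((q * ⌊y⌋₊ : ℕ) : ℝ) ≤ q := by
    have h1 := Nat.floor_le (mul_nonneg hq0.le hypos.le)
    have h2 := Nat.lt_floor_add_one y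
    push_cast
    nlinarith
  have hup : ⌊(q : ℝ) * y⌋₊ ≤ q ^ (n + 1 + 3) := by
    rw [← hy1]
    exact (floor_rpow_le hq (n + 1) 2 (by exact_mod_cast hu.2)).trans
      (Nat.pow_le_pow_right (by omega) (by omega))
  have hdiff := norm_sub_le_of_norm_succ_sub_le hq hR hc hX (n := n + 1)
    (by rw [pow_succ, mul_comm]; gcongr) hfl hup
  have hs : scaledSeq q T X u (n + 1) - scaledSeq q T X u n =
      T (-(u + ((n + 1 : ℕ) : ℝ))) (X ⌊(q : ℝ) * y⌋₊ - X (q * ⌊y⌋₊)) := by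
    rw [map_sub, h.apply_mul _ hk1, scaledSeq, scaledSeq, hy1]
    congr 1
    rw [show -(u + (n : ℝ)) = -(u + ((n + 1 : ℕ) : ℝ)) + 1 by push_cast; ring, h.map_add]
    rfl
  rw [hs]
  refine (ContinuousLinearMap.le_opNorm _ _).trans ?_
  calc _ ≤ (cT * (1 + μ ^ (-2 : ℝ)) * (μ ^ (n + 1))⁻¹) *
        (c * (max 1 R) ^ 3 * R ^ (n + 1) * q) := by
        gcongr
        · exact norm_apply_neg_le hμ hcT hT hu (n + 1)
        · exact hdiff.trans (by gcongr)
    _ = _ := by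
        rw [div_pow, pow_succ μ, pow_succ R]
        field_simp

theorem norm_scaledSeq_sub_le {K r : ℝ} (hr1 : r < 1) {s : Set ℝ}
    (hs : ∀ u ∈ s, ∀ n, ‖scaledSeq q T X u (n + 1) - scaledSeq q T X u n‖ ≤ K * r ^ n)
    {G : ℝ → E} (hG : ∀ u ∈ s, Tendsto (scaledSeq q T X u) atTop (𝓝 (G u))) :
    ∀ u ∈ s, ∀ n, ‖scaledSeq q T X u n - G u‖ ≤ K / (1 - r) * r ^ n := by
  intro u hu n
  have := dist_le_of_le_geometric_of_tendsto r K hr1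
    (fun n => by rw [dist_comm, dist_eq_norm]; exact hs u hu n) (hG u hu) n
  rw [dist_eq_norm] at this
  refine this.trans (le_of_eq ?_)
  ring

/-- Telescoping against a geometric series from n = 0, where u ≤ 2 lets only the values X k with k ≤
q^2 occur. -/
theorem IsSelfSimilar.exists_norm_scaledSeq_le (h : IsSelfSimilar q T X R) {μ : ℝ} (hμ : R < μ)
    (hT : HasDecay T μ) :
    ∃ B, 0 ≤ B ∧ ∀ u ∈ Set.Icc (0 : ℝ) 2, ∀ n, ‖scaledSeq q T X u n‖ ≤ B := by
  have hμ0 : 0 < μ := h.pos.trans hμ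
  obtain ⟨K, hK, hs⟩ := norm_scaledSeq_succ_sub_le h hμ0 hT
  obtain ⟨cT, hcT, hT⟩ := hT
  have hr0 : 0 ≤ R / μ := div_nonneg h.pos.le hμ0.le
  have hr1 : R / μ < 1 := by rwa [div_lt_one hμ0]
  have hr : 0 < 1 - R / μ := by linarith
  refine ⟨cT * (1 + μ ^ (-2 : ℝ)) * (∑ k ∈ Finset.range (q ^ 2 + 1), ‖X k‖) + K / (1 - R / μ),
    by positivity, fun u hu n => ?_⟩
  have h0 : ‖scaledSeq q T X u 0‖ ≤
      cT * (1 + μ ^ (-2 : ℝ)) * (∑ k ∈ Finset.range (q ^ 2 + 1), ‖X k‖) := by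
    refine (ContinuousLinearMap.le_opNorm _ _).trans ?_
    gcongr
    · simpa using norm_apply_neg_le hμ0 hcT hT hu 0
    · refine Finset.single_le_sum (f := fun k => ‖X k‖) (fun k _ => norm_nonneg _)
        (Finset.mem_range.mpr (Nat.lt_succ_of_le ?_))
      have := floor_rpow_le h.two_le 0 2 (by exact_mod_cast hu.2)
      rwa [zero_add] at this
  have h1 := dist_le_range_sum_of_dist_le (f := scaledSeq q T X u)
    (d := fun n => K * (R / μ) ^ n) n
    (fun {k} _ => by rw [dist_comm, dist_eq_norm]; exact hs u hu k)
  have h2 : ∑ i ∈ Finset.range n, K * (R / μ) ^ i ≤ K / (1 - R / μ) := by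
    rw [← Finset.mul_sum, div_eq_mul_inv K, ← tsum_geometric_of_lt_one hr0 hr1]
    gcongr
    exact (summable_geometric_of_lt_one hr0 hr1).sum_le_tsum _ (fun i _ => by positivity)
  rw [dist_eq_norm] at h1
  calc ‖scaledSeq q T X u n‖
      = ‖scaledSeq q T X u 0 - (scaledSeq q T X u 0 - scaledSeq q T X u n)‖ := by congr 1; abel
    _ ≤ _ := (norm_sub_le _ _).trans (add_le_add h0 (h1.trans h2))

theorem rpow_sub_rpow_le (hq : 2 ≤ q) {u v : ℝ} (hv : v ≤ 2) (huv : u ≤ v) :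
    (q : ℝ) ^ v - (q : ℝ) ^ u ≤ (q : ℝ) ^ 2 * Real.log q * (v - u) := by
  have hq0 : (0 : ℝ) < q := by exact_mod_cast (by omega : 0 < q)
  have hq1 : (1 : ℝ) ≤ q := by exact_mod_cast (by omega : 1 ≤ q)
  have h1 : (q : ℝ) ^ u = (q : ℝ) ^ v * Real.exp (-(Real.log q * (v - u))) := by
    rw [Real.rpow_def_of_pos hq0, Real.rpow_def_of_pos hq0, ← Real.exp_add]
    ring_nf
  have h2 := Real.add_one_le_exp (-(Real.log q * (v - u)))
  have h3 : (q : ℝ) ^ v ≤ (q : ℝ) ^ 2 := by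
    rw [← Real.rpow_natCast]
    exact Real.rpow_le_rpow_of_exponent_le hq1 (by exact_mod_cast hv)
  have h4 : 0 ≤ Real.log q * (v - u) :=
    mul_nonneg (Real.log_nonneg hq1) (by linarith)
  calc (q : ℝ) ^ v - (q : ℝ) ^ u
      = (q : ℝ) ^ v * (1 - Real.exp (-(Real.log q * (v - u)))) := by rw [h1]; ring
    _ ≤ (q : ℝ) ^ v * (Real.log q * (v - u)) := by gcongr; linarith
    _ ≤ (q : ℝ) ^ 2 * (Real.log q * (v - u)) := by gcongr
    _ = _ := by ring

/-- Two effects are separated: moving the index from ⌊q^(u+n)⌋ to ⌊q^(v+n)⌋, and moving the group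
parameter by v - u. The first costs (R/μ)^n, the second is Lipschitz. -/
theorem IsSelfSimilar.exists_norm_scaledSeq_sub_le (h : IsSelfSimilar q T X R) {μ : ℝ}
    (hμ : R < μ) (hT : HasDecay T μ) :
    ∃ K, 0 ≤ K ∧ ∀ u ∈ Set.Icc (0 : ℝ) 2, ∀ v ∈ Set.Icc (0 : ℝ) 2, ∀ n : ℕ, u ≤ v →
      v - u ≤ ((q : ℝ)⁻¹) ^ n →
      ‖scaledSeq q T X v n - scaledSeq q T X u n‖ ≤ K * ((R / μ) ^ n + (v - u)) := by
  have hμ0 : 0 < μ := h.pos.trans hμ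
  obtain ⟨B, hB, hbd⟩ := h.exists_norm_scaledSeq_le hμ hT
  obtain ⟨cT, hcT, hT⟩ := hT
  obtain ⟨c, hc, hX⟩ := h.increment
  obtain ⟨L, hL, hlip⟩ := h.lipschitz 2
  have hq := h.two_le
  have hR := h.pos
  have hq0 : (0 : ℝ) < q := by exact_mod_cast (by omega : 0 < q)
  have hq1 : (1 : ℝ) ≤ q := by exact_mod_cast (by omega : 1 ≤ q)
  have hlog := Real.log_nonneg hq1
  set K₁ := cT * (1 + μ ^ (-2 : ℝ)) * (c * (max 1 R) ^ 3 * ((q : ℝ) ^ 2 * Real.log q + 1))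
    with hK₁
  have hK₁0 : 0 ≤ K₁ := by positivity
  refine ⟨K₁ + L * B, by positivity, fun u hu v hv n huv hn => ?_⟩
  set a := ⌊(q : ℝ) ^ (u + n)⌋₊ with ha
  set b := ⌊(q : ℝ) ^ (v + n)⌋₊ with hb
  have hab : a ≤ b :=
    Nat.floor_le_floor (Real.rpow_le_rpow_of_exponent_le hq1 (by linarith))
  have hbn : b ≤ q ^ (n + 3) := (floor_rpow_le hq n 2 (by exact_mod_cast hv.2)).trans
    (Nat.pow_le_pow_right (by omega) (by omega))
  have hdiff := norm_sub_le_of_norm_succ_sub_le hq hR hc hX (le_floor_rpow hq hu.1 n) hab hbn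
  -- As v - u ≤ q^(-n), the two indices differ by an amount bounded independently of n.
  have hba : (b : ℝ) - a ≤ (q : ℝ) ^ 2 * Real.log q + 1 := by
    have h1 := Nat.floor_le (a := (q : ℝ) ^ (v + n)) (by positivity)
    have h2 := Nat.lt_floor_add_one ((q : ℝ) ^ (u + n))
    rw [← hb, Real.rpow_add hq0, Real.rpow_natCast] at h1
    rw [← ha, Real.rpow_add hq0, Real.rpow_natCast] at h2
    have h3 := rpow_sub_rpow_le hq hv.2 huv
    have h4 : (v - u) * (q : ℝ) ^ n ≤ 1 := by
      rwa [inv_pow, ← one_div, le_div_iff₀ (by positivity)] at hn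
    have h5 : ((q : ℝ) ^ v - (q : ℝ) ^ u) * (q : ℝ) ^ n ≤ (q : ℝ) ^ 2 * Real.log q := by
      calc _ ≤ (q : ℝ) ^ 2 * Real.log q * (v - u) * (q : ℝ) ^ n := by gcongr
        _ = (q : ℝ) ^ 2 * Real.log q * ((v - u) * (q : ℝ) ^ n) := by ring
        _ ≤ (q : ℝ) ^ 2 * Real.log q * 1 := by gcongr
        _ = _ := mul_one _
    linarith
  have hs : scaledSeq q T X v n - scaledSeq q T X u n =
      T (-(v + n)) (X b - X a) + (T (-(v - u)) - 1) (scaledSeq q T X u n) := by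
    have : T (-(v + n)) (X a) = T (-(v - u)) (T (-(u + n)) (X a)) := by
      rw [show -(v + (n : ℝ)) = -(v - u) + -(u + n) by ring, h.map_add]
      rfl
    rw [map_sub, this]
    simp [scaledSeq, ← ha, ← hb]
  have e1 : ‖T (-(v + n)) (X b - X a)‖ ≤ K₁ * (R / μ) ^ n := by
    refine (ContinuousLinearMap.le_opNorm _ _).trans ?_
    calc _ ≤ (cT * (1 + μ ^ (-2 : ℝ)) * (μ ^ n)⁻¹) *
          (c * (max 1 R) ^ 3 * R ^ n * ((q : ℝ) ^ 2 * Real.log q + 1)) := by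
          gcongr
          · exact norm_apply_neg_le hμ0 hcT hT hv n
          · exact hdiff.trans (by gcongr)
      _ = _ := by
          rw [div_pow, hK₁]
          field_simp
  have e2 : ‖(T (-(v - u)) - 1) (scaledSeq q T X u n)‖ ≤ L * (v - u) * B := by
    refine (ContinuousLinearMap.le_opNorm _ _).trans ?_
    have habs : |(-(v - u))| = v - u := by rw [abs_neg, abs_of_nonneg (by linarith)]
    have := hlip (-(v - u)) (by rw [habs]; linarith [hv.2, hu.1])
    rw [habs] at this
    exact mul_le_mul this (hbd u hu n) (norm_nonneg _) (mul_nonneg hL (by linarith))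
  rw [hs]
  have e3 : 0 ≤ (R / μ) ^ n := by positivity
  have e4 : 0 ≤ L * B := by positivity
  have e5 : 0 ≤ v - u := by linarith
  refine (norm_add_le _ _).trans ((add_le_add e1 e2).trans ?_)
  nlinarith [mul_nonneg e4 e3, mul_nonneg hK₁0 e5]

/-- Taking μ = R q^α makes the convergence ratio R/μ equal to q^(-α). The discretisation error at
stage n is then of order q^(-αn), to be balanced against |u - v|^α. -/
theorem IsSelfSimilar.exists_holder_Icc (h : IsSelfSimilar q T X R) {α : ℝ} (hα : 0 < α)
    (hα1 : α ≤ 1) (hT : HasDecay T (R * (q : ℝ) ^ α)) {G : ℝ → E}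
    (hG : ∀ u ∈ Set.Icc (0 : ℝ) 2, Tendsto (scaledSeq q T X u) atTop (𝓝 (G u))) :
    ∃ L, 0 ≤ L ∧ ∀ u ∈ Set.Icc (0 : ℝ) 2, ∀ v ∈ Set.Icc (0 : ℝ) 2, |u - v| ≤ 1 →
      ‖G u - G v‖ ≤ L * |u - v| ^ α := by
  have hq := h.two_le
  have hR := h.pos
  have hq0 : (0 : ℝ) < q := by exact_mod_cast (by omega : 0 < q)
  have hq1 : (1 : ℝ) < q := by exact_mod_cast (by omega : 1 < q)
  have hqα : 1 < (q : ℝ) ^ α := Real.one_lt_rpow hq1 hα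
  have hμ : R < R * (q : ℝ) ^ α := lt_mul_of_one_lt_right hR hqα
  have hr : R / (R * (q : ℝ) ^ α) = ((q : ℝ)⁻¹) ^ α := by
    rw [Real.inv_rpow hq0.le]
    field_simp
  obtain ⟨K, hK, hs⟩ := norm_scaledSeq_succ_sub_le h (hR.trans hμ) hT
  obtain ⟨K₂, hK₂, hs₂⟩ := h.exists_norm_scaledSeq_sub_le hμ hT
  rw [hr] at hs hs₂
  have hr1 : ((q : ℝ)⁻¹) ^ α < 1 := by
    rw [Real.inv_rpow hq0.le]
    exact inv_lt_one_of_one_lt₀ hqα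
  have htail := norm_scaledSeq_sub_le hr1 hs hG
  set K₁ := K / (1 - ((q : ℝ)⁻¹) ^ α) with hK₁
  have hK₁0 : 0 ≤ K₁ := div_nonneg hK (by linarith)
  have key : ∀ u ∈ Set.Icc (0 : ℝ) 2, ∀ v ∈ Set.Icc (0 : ℝ) 2, u < v → v - u ≤ 1 →
      ‖G v - G u‖ ≤ ((2 * K₁ + K₂) * (q : ℝ) ^ α + K₂) * (v - u) ^ α := by
    intro u hu v hv huv h1
    have hh : 0 < v - u := by linarith
    -- The scale n satisfies q^(-(n+1)) < v - u ≤ q^(-n), hence q^(-αn) ≤ q^α (v - u)^α.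
    obtain ⟨n, hn1, hn2⟩ := exists_nat_pow_near_of_lt_one hh h1 (inv_pos.mpr hq0)
      (inv_lt_one_of_one_lt₀ hq1)
    have hpow : (((q : ℝ)⁻¹) ^ α) ^ n ≤ (q : ℝ) ^ α * (v - u) ^ α := by
      have : (((q : ℝ)⁻¹) ^ (n + 1)) ^ α ≤ (v - u) ^ α :=
        Real.rpow_le_rpow (by positivity) hn1.le hα.le
      rw [← Real.rpow_natCast, ← Real.rpow_mul (by positivity), mul_comm,
        Real.rpow_mul (by positivity), Real.rpow_natCast, pow_succ] at this
      have e : (q : ℝ) ^ α * ((q : ℝ)⁻¹) ^ α = 1 := by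
        rw [Real.inv_rpow hq0.le]
        field_simp
      calc (((q : ℝ)⁻¹) ^ α) ^ n
          = (q : ℝ) ^ α * ((((q : ℝ)⁻¹) ^ α) ^ n * ((q : ℝ)⁻¹) ^ α) := by
            rw [mul_left_comm, e, mul_one]
        _ ≤ _ := by gcongr
    have hlin : v - u ≤ (v - u) ^ α := by
      conv_lhs => rw [← Real.rpow_one (v - u)]
      exact Real.rpow_le_rpow_of_exponent_ge hh h1 hα1
    have e1 := htail u hu n
    have e2 := htail v hv n
    have e3 := hs₂ u hu v hv n huv.le hn2
    have e4 : ‖G v - G u‖ ≤ ‖scaledSeq q T X v n - scaledSeq q T X u n‖ +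
        ‖scaledSeq q T X u n - G u‖ + ‖scaledSeq q T X v n - G v‖ := by
      calc ‖G v - G u‖ = ‖(scaledSeq q T X v n - scaledSeq q T X u n) +
          (scaledSeq q T X u n - G u) - (scaledSeq q T X v n - G v)‖ := by congr 1; abel
        _ ≤ _ := (norm_sub_le _ _).trans (by gcongr; exact norm_add_le _ _)
    have e5 := mul_le_mul_of_nonneg_left hpow (by positivity : 0 ≤ 2 * K₁ + K₂)
    have e6 := mul_le_mul_of_nonneg_left hlin hK₂
    nlinarith
  refine ⟨(2 * K₁ + K₂) * (q : ℝ) ^ α + K₂, by positivity, fun u hu v hv h1 => ?_⟩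
  rcases lt_trichotomy u v with huv | rfl | huv
  · rw [abs_sub_comm, abs_of_pos (by linarith : 0 < v - u)] at *
    rw [norm_sub_rev]
    exact key u hu v hv huv h1
  · simp [Real.zero_rpow hα.ne']
  · rw [abs_of_pos (by linarith : 0 < u - v)] at *
    exact key v hv u hu huv h1

theorem scaledSeq_add_natCast (u : ℝ) (k n : ℕ) :
    scaledSeq q T X (u + k) n = scaledSeq q T X u (n + k) := by
  rw [scaledSeq, scaledSeq, show u + (k : ℝ) + n = u + ((n + k : ℕ) : ℝ) by push_cast; ring]

theorem IsSelfSimilar.apply_pow_mul (h : IsSelfSimilar q T X R) {N : ℕ} (hN : 1 ≤ N) (n : ℕ) :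
    X (q ^ n * N) = T n (X N) := by
  induction n with
  | zero => simp [h.map_zero]
  | succ n ih =>
    have hq := h.two_le
    rw [pow_succ', mul_assoc, h.apply_mul _ (Nat.mul_pos (by positivity) hN), ih]
    push_cast
    rw [add_comm (n : ℝ), h.map_add]
    rfl

theorem IsSelfSimilar.scaledSeq_logb (h : IsSelfSimilar q T X R) {N : ℕ} (hN : 1 ≤ N) (n : ℕ) :
    scaledSeq q T X (Real.logb q N) n = T (-Real.logb q N) (X N) := by
  have hq := h.two_le
  have hq1 : (1 : ℝ) < q := by exact_mod_cast (by omega : 1 < q)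
  have hN0 : (0 : ℝ) < N := by exact_mod_cast hN
  have h1 : (q : ℝ) ^ (Real.logb q N + n) = ((q ^ n * N : ℕ) : ℝ) := by
    rw [Real.rpow_add (by linarith), Real.rpow_logb (by linarith) hq1.ne' hN0, Real.rpow_natCast]
    push_cast
    ring
  rw [scaledSeq, h1, Nat.floor_natCast, h.apply_pow_mul hN]
  conv_rhs => rw [show -Real.logb q N = -(Real.logb q N + n) + n by ring, h.map_add]
  rfl

theorem IsSelfSimilar.exists_periodic [CompleteSpace E] (h : IsSelfSimilar q T X R)
    (hT : ∃ μ, R < μ ∧ HasDecay T μ) :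
    ∃ Ψ : ℝ → E, Function.Periodic Ψ 1 ∧
      (∀ N, 1 ≤ N → X N = T (Real.logb q N) (Ψ (Real.logb q N))) ∧
      (∀ u, 0 ≤ u → Tendsto (scaledSeq q T X u) atTop (𝓝 (Ψ u))) ∧
      ∀ α : ℝ, 0 < α → α ≤ 1 → HasDecay T (R * (q : ℝ) ^ α) →
        ∃ L, 0 ≤ L ∧ ∀ u v, ‖Ψ u - Ψ v‖ ≤ L * |u - v| ^ α := by
  obtain ⟨μ, hμ, hT⟩ := hT
  have hq1 : (1 : ℝ) < q := by exact_mod_cast (by have := h.two_le; omega : 1 < q)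
  have hμ0 : 0 < μ := h.pos.trans hμ
  have hr1 : R / μ < 1 := by rwa [div_lt_one hμ0]
  obtain ⟨K, hK, hs⟩ := norm_scaledSeq_succ_sub_le h hμ0 hT
  -- Limits are taken at the fractional part, which makes periodicity immediate; for other u ≥ 0 the
  -- sequence is an index shift of the one at the fractional part.
  have hex : ∀ u : ℝ, ∃ x, Tendsto (scaledSeq q T X (Int.fract u)) atTop (𝓝 x) := fun u =>
    cauchySeq_tendsto_of_complete (cauchySeq_of_le_geometric (R / μ) K hr1 fun n => by
      rw [dist_comm, dist_eq_norm]
      exact hs _ ⟨Int.fract_nonneg u, (Int.fract_lt_one u).le.trans one_le_two⟩ n)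
  choose Ψ₀ hΨ₀ using hex
  set Ψ : ℝ → E := fun u => Ψ₀ (Int.fract u) with hΨdef
  have hΨf : ∀ u, Tendsto (scaledSeq q T X (Int.fract u)) atTop (𝓝 (Ψ u)) := fun u => by
    simpa using hΨ₀ (Int.fract u)
  have hper : Function.Periodic Ψ 1 := fun u => by simp [hΨdef]
  have hΨ : ∀ u, 0 ≤ u → Tendsto (scaledSeq q T X u) atTop (𝓝 (Ψ u)) := by
    intro u hu
    have e : scaledSeq q T X u = fun n => scaledSeq q T X (Int.fract u) (n + ⌊u⌋₊) := by
      funext n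
      rw [← scaledSeq_add_natCast, natCast_floor_eq_intCast_floor hu, Int.fract_add_floor]
    rw [e]
    exact (hΨf u).comp (tendsto_add_atTop_nat _)
  obtain ⟨B, hB, hbd⟩ := h.exists_norm_scaledSeq_le hμ hT
  have hΨB : ∀ u, ‖Ψ u‖ ≤ B := fun u =>
    le_of_tendsto (hΨf u).norm (Eventually.of_forall fun n =>
      hbd _ ⟨Int.fract_nonneg u, (Int.fract_lt_one u).le.trans one_le_two⟩ n)
  refine ⟨Ψ, hper, fun N hN => ?_, hΨ, fun α hα hα1 hdec => ?_⟩
  · have hl : 0 ≤ Real.logb q N := Real.logb_nonneg hq1 (by exact_mod_cast hN)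
    have h1 := hΨ _ hl
    simp_rw [funext (h.scaledSeq_logb hN)] at h1
    rw [← tendsto_nhds_unique tendsto_const_nhds h1, ← mul_apply_eq_comp, ← h.map_add,
      add_neg_cancel, h.map_zero, one_apply_eq_self]
  · obtain ⟨L, hL, hH⟩ := h.exists_holder_Icc hα hα1 hdec fun u hu => hΨ u hu.1
    have key : ∀ u v, u ≤ v → v - u ≤ 1 → ‖Ψ u - Ψ v‖ ≤ L * |u - v| ^ α := by
      intro u v huv h1
      -- Translation by ⌊u⌋ puts u into [0,1) and v into [0,2]; this is why the estimates are made
      -- on an interval of length two.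
      have e : ∀ x, Ψ (x - ⌊u⌋) = Ψ x := fun x => by simpa using hper.sub_int_mul_eq ⌊u⌋ (x := x)
      have h2 := Int.floor_le u
      have h3 := Int.lt_floor_add_one u
      have := hH (u - ⌊u⌋) ⟨by linarith, by linarith⟩ (v - ⌊u⌋) ⟨by linarith, by linarith⟩
      rw [e, e, sub_sub_sub_cancel_right] at this
      exact this (by rw [abs_sub_comm, abs_of_nonneg (by linarith)]; exact h1)
    refine ⟨L + 2 * B, by positivity, fun u v => ?_⟩
    have hpos : 0 ≤ |u - v| ^ α := by positivity
    rcases le_or_gt |u - v| 1 with h1 | h1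
    · have : ‖Ψ u - Ψ v‖ ≤ L * |u - v| ^ α := by
        rcases le_total u v with huv | huv
        · rw [abs_sub_comm, abs_of_nonneg (by linarith)] at h1
          exact key u v huv h1
        · rw [abs_of_nonneg (by linarith)] at h1
          rw [norm_sub_rev, abs_sub_comm]
          exact key v u huv h1
      nlinarith
    -- At distance greater than 1, boundedness of Ψ suffices.
    · have h2 := Real.one_le_rpow h1.le hα.le
      have h3 := norm_sub_le (Ψ u) (Ψ v)
      have h4 := hΨB u
      have h5 := hΨB v
      nlinarith

end Periodic

theorem holderWith_of_norm_sub_le {V : Type*} [NormedAddCommGroup V] {f : ℝ → V} {α : NNReal}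
    {L : ℝ} (hL : 0 ≤ L) (h : ∀ u v, ‖f u - f v‖ ≤ L * |u - v| ^ (α : ℝ)) :
    HolderWith L.toNNReal α f := by
  intro u v
  have := h u v
  rw [edist_dist, edist_dist, dist_eq_norm, Real.dist_eq,
    ENNReal.ofReal_rpow_of_nonneg (abs_nonneg _) (NNReal.coe_nonneg α),
    show ((L.toNNReal : NNReal) : ENNReal) = ENNReal.ofReal L from rfl, ← ENNReal.ofReal_mul hL]
  exact ENNReal.ofReal_le_ofReal this

/-! ### Jordan chains as vectors moved by a nilpotent shift -/

section Shift

variable {V : Type*} [NormedAddCommGroup V] [NormedSpace ℂ V]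

/-- The map `y ↦ (s y₁, …, s yₙ, 0)` on `V ^ (n + 1)`. -/
def scaledShift (V : Type*) [NormedAddCommGroup V] [NormedSpace ℂ V] (n : ℕ) (s : ℂ) :
    (Fin (n + 1) → V) →L[ℂ] (Fin (n + 1) → V) :=
  ContinuousLinearMap.pi fun i => s •
    if h : (i : ℕ) + 1 < n + 1 then ContinuousLinearMap.proj ⟨i + 1, h⟩ else 0

theorem scaledShift_apply (n : ℕ) (s : ℂ) (y : Fin (n + 1) → V) (i : Fin (n + 1)) :
    scaledShift V n s y i = s • if h : (i : ℕ) + 1 < n + 1 then y ⟨i + 1, h⟩ else 0 := by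
  rw [scaledShift, ContinuousLinearMap.pi_apply, _root_.smul_apply]
  split_ifs <;> rfl

theorem scaledShift_pow_apply (n : ℕ) (s : ℂ) (k : ℕ) (y : Fin (n + 1) → V) (i : Fin (n + 1)) :
    (scaledShift V n s ^ k) y i =
      s ^ k • if h : (i : ℕ) + k < n + 1 then y ⟨i + k, h⟩ else 0 := by
  induction k generalizing y with
  | zero =>
    have h : (i : ℕ) + 0 < n + 1 := i.2
    rw [dif_pos h]
    simp
  | succ k ih =>
    rw [pow_succ, mul_apply_eq_comp, ih, pow_succ, mul_smul]
    congr 1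
    by_cases h1 : (i : ℕ) + k < n + 1
    · rw [dif_pos h1, scaledShift_apply]
      rfl
    · rw [dif_neg h1, dif_neg (by omega), smul_zero]

theorem scaledShift_pow_eq_zero (n : ℕ) (s : ℂ) : scaledShift V n s ^ (n + 1) = 0 := by
  ext y i
  rw [scaledShift_pow_apply, dif_neg (by omega)]
  simp

/-- No later coordinate feeds into the last one, so it evolves by the scalar factor alone. -/
theorem jordanPow_scaledShift_apply_last (n : ℕ) (s lam : ℂ) (t : ℝ) (y : Fin (n + 1) → V) :
    jordanPow lam (scaledShift V n s) (n + 1) t y (Fin.last n) =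
      Complex.exp (t * Complex.log lam) • y (Fin.last n) := by
  rw [jordanPow, unipotentPow, _root_.smul_apply, Pi.smul_apply,
    _root_.sum_apply, Finset.sum_apply, Finset.sum_eq_single_of_mem 0 (by simp)]
  · simp
  · intro k _ hk
    rw [_root_.smul_apply, Pi.smul_apply, scaledShift_pow_apply,
      dif_neg (by rw [Fin.val_last]; omega)]
    simp

theorem exists_holder_exponent {q : ℕ} (hq : 2 ≤ q) {R l : ℝ} (hl : R < l) :
    ∃ α : NNReal, 0 < α ∧ (α : ℝ) ≤ 1 ∧ R * (q : ℝ) ^ (α : ℝ) < l := by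
  have hq1 : (1 : ℝ) < q := by exact_mod_cast (by omega : 1 < q)
  have hcont : Tendsto (fun a : ℝ => R * (q : ℝ) ^ a) (𝓝[>] 0) (𝓝 (R * (q : ℝ) ^ (0 : ℝ))) :=
    ((Real.continuous_const_rpow (by linarith)).const_mul R).continuousAt.mono_left
      nhdsWithin_le_nhds
  rw [Real.rpow_zero, mul_one] at hcont
  obtain ⟨a, ha, ha1⟩ := ((hcont.eventually_lt_const hl).and
    (Ioc_mem_nhdsGT (zero_lt_one (α := ℝ)))).exists
  exact ⟨⟨a, ha1.1.le⟩, ha1.1, ha1.2, ha⟩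

theorem exists_shift_expansion [CompleteSpace V] {q : ℕ} (hq : 2 ≤ q) {R : ℝ} (hR : 0 < R) {lam : ℂ}
    (hlam : R < ‖lam‖) (n : ℕ) (x : ℕ → ℕ → V)
    (hx : ∀ k ≤ n, ∀ N, 1 ≤ N → x k (q * N) = lam • x k N + x (k + 1) N)
    (hxn : ∀ N, x (n + 1) N = 0)
    (hinc : ∃ c, 0 ≤ c ∧ ∀ k ≤ n, ∀ N, 1 ≤ N →
      ‖x k (N + 1) - x k N‖ ≤ c * R ^ Nat.log q N) :
    ∃ Φ : ℕ → ℝ → V, (∀ k, Function.Periodic (Φ k) 1) ∧ (∀ k, Continuous (Φ k)) ∧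
      (∀ N, 1 ≤ N → x 0 N = Complex.exp ((Real.logb q N : ℝ) * Complex.log lam) •
        ∑ k ∈ Finset.range (n + 1), (Real.logb q N : ℂ) ^ k • Φ k (Real.logb q N)) ∧
      (∀ k, ∀ α : NNReal, 0 < α → (α : ℝ) ≤ 1 → R * (q : ℝ) ^ (α : ℝ) < ‖lam‖ →
        ∃ L : NNReal, HolderWith L α (Φ k)) ∧
      ∀ u v, 0 ≤ u → Tendsto (fun j : ℕ => Complex.exp ((-(u + j) : ℝ) * Complex.log lam) •
          x n ⌊(q : ℝ) ^ (u + j)⌋₊) atTop (𝓝 v) →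
        Φ n u = ((n.factorial : ℂ) * lam ^ n)⁻¹ • v := by
  have hl0 : lam ≠ 0 := by
    rintro rfl
    rw [norm_zero] at hlam
    linarith
  have hq1 : (1 : ℝ) < q := by exact_mod_cast (by omega : 1 < q)
  -- With this scale, lam (1 + a) maps y_k to lam y_k + y_(k+1), which is the given recursion.
  set a := scaledShift V n lam⁻¹ with ha
  have hnil : a ^ (n + 1) = 0 := scaledShift_pow_eq_zero n lam⁻¹
  set T : ℝ → (Fin (n + 1) → V) →L[ℂ] (Fin (n + 1) → V) := jordanPow lam a (n + 1) with hT
  set X : ℕ → Fin (n + 1) → V := fun N i => x i N with hX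
  obtain ⟨c, hc, hinc⟩ := hinc
  have hdec : ∀ μ, 0 < μ → μ < ‖lam‖ → HasDecay T μ := fun μ h0 h1 =>
    exists_norm_jordanPow_neg_le a (n + 1) h0 h1
  have hself : IsSelfSimilar q T X R :=
    { two_le := hq
      pos := hR
      map_zero := jordanPow_zero n.succ_pos
      map_add := jordanPow_add hnil
      lipschitz := exists_norm_jordanPow_sub_one_le lam a n.succ_pos
      apply_mul := fun N hN => by
        funext i
        have h1 := scaledShift_pow_apply n lam⁻¹ 1 (X N) i
        rw [pow_one, pow_one, ← ha] at h1
        rw [hT, jordanPow_one hl0 n.succ_pos hnil]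
        simp only [_root_.smul_apply, _root_.add_apply,
          one_apply_eq_self, Pi.smul_apply, Pi.add_apply, h1]
        rw [smul_add, smul_inv_smul₀ hl0]
        simp only [hX]
        rw [hx i (Nat.lt_succ_iff.mp i.2) N hN]
        congr 1
        split_ifs with h
        · rfl
        · rw [show (i : ℕ) = n by omega, hxn]
      increment := ⟨c, hc, fun N hN => by
        rw [pi_norm_le_iff_of_nonneg (by positivity)]
        exact fun i => hinc i (Nat.lt_succ_iff.mp i.2) N hN⟩ }
  obtain ⟨μ, hμ1, hμ2⟩ := exists_between hlam
  obtain ⟨Ψ, hper, hXΨ, hlim, hhol⟩ := hself.exists_periodic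
    ⟨μ, hμ1, hdec μ (hR.trans hμ1) hμ2⟩
  set Φ : ℕ → ℝ → V := fun k u => unipotentCoeff a (n + 1) k (Ψ u) 0 with hΦ
  have hΦhol : ∀ k, ∀ α : NNReal, 0 < α → (α : ℝ) ≤ 1 → R * (q : ℝ) ^ (α : ℝ) < ‖lam‖ →
      ∃ L : NNReal, HolderWith L α (Φ k) := by
    intro k α hα hα1 hα2
    obtain ⟨L, hL, hH⟩ := hhol α hα hα1 (hdec _ (by positivity) hα2)
    refine ⟨_, holderWith_of_norm_sub_le (L := ‖unipotentCoeff a (n + 1) k‖ * L) (by positivity)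
      fun u v => ?_⟩
    simp only [hΦ]
    rw [← Pi.sub_apply, ← map_sub, mul_assoc]
    refine (norm_le_pi_norm _ 0).trans ((ContinuousLinearMap.le_opNorm _ _).trans ?_)
    gcongr
    exact hH u v
  refine ⟨Φ, fun k u => ?_, fun k => ?_, fun N hN => ?_, hΦhol, fun u v hu hv => ?_⟩
  · simp only [hΦ, hper u]
  · obtain ⟨α, hα, hα1, hα2⟩ := exists_holder_exponent hq hlam
    obtain ⟨L, hL⟩ := hΦhol k α hα hα1 hα2
    exact hL.continuous hα
  · have h1 : x 0 N = X N 0 := rfl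
    rw [h1, hXΨ N hN, hT, jordanPow, unipotentPow_eq_sum]
    simp [hΦ]
  -- The coefficient of t^n is a^n / n!, whose coordinate 0 is lam^(-n) y_n / n!. So only the last
  -- coordinate of Ψ matters, and it is a limit of scalar multiples of x n.
  · have h1 : Tendsto (fun j => scaledSeq q T X u j (Fin.last n)) atTop (𝓝 (Ψ u (Fin.last n))) :=
      (continuous_apply _).tendsto _ |>.comp (hlim u hu)
    have h2 : (fun j => scaledSeq q T X u j (Fin.last n)) = fun j : ℕ =>
        Complex.exp ((-(u + j) : ℝ) * Complex.log lam) • x n ⌊(q : ℝ) ^ (u + j)⌋₊ := by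
      funext j
      rw [scaledSeq, hT, ha, jordanPow_scaledShift_apply_last]
      rfl
    rw [h2] at h1
    rw [tendsto_nhds_unique hv h1]
    simp only [hΦ]
    rw [unipotentCoeff_top, _root_.smul_apply, Pi.smul_apply, ha,
      scaledShift_pow_apply, dif_pos (by simp), smul_smul, mul_inv, inv_pow]
    congr 2
    exact Fin.ext (by simp)

end Shift

namespace MatrixProducts

variable {q d : ℕ}

/-! ### Norm equivalence and bounds for matrix products -/

theorem exists_seminorm_le_norm (ν : Seminorm ℂ (Fin d → ℂ)) :
    ∃ b, 0 < b ∧ ∀ x, ν x ≤ b * ‖x‖ := by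
  refine ⟨∑ i, ν (Pi.single i 1) + 1,
    by have : 0 ≤ ∑ i, ν (Pi.single i (1 : ℂ)) := Finset.sum_nonneg fun i _ => apply_nonneg _ _
       linarith, fun x => ?_⟩
  have h1 : ν x ≤ ∑ i, ‖x i‖ * ν (Pi.single i 1) := by
    conv_lhs => rw [pi_eq_sum_univ' x]
    refine (Finset.le_sum_of_subadditive ν (map_zero ν).le (map_add_le_add ν) _ _).trans
      (Finset.sum_le_sum fun i _ => ?_)
    rw [map_smul_eq_mul]
  have h2 : ∑ i, ‖x i‖ * ν (Pi.single i 1) ≤ (∑ i, ν (Pi.single i 1)) * ‖x‖ := by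
    rw [Finset.sum_mul]
    refine Finset.sum_le_sum fun i _ => ?_
    rw [mul_comm]
    gcongr
    exact norm_le_pi_norm x i
  have := norm_nonneg x
  nlinarith

theorem exists_norm_le_seminorm (ν : Seminorm ℂ (Fin d → ℂ)) (hν : ∀ x, ν x = 0 → x = 0) :
    ∃ a, 0 < a ∧ ∀ x, ‖x‖ ≤ a * ν x := by
  obtain ⟨b, hb, hle⟩ := exists_seminorm_le_norm ν
  have hcont : Continuous ν := by
    refine Seminorm.continuous_of_continuousAt_zero ?_
    rw [ContinuousAt, map_zero]
    refine squeeze_zero (fun x => apply_nonneg ν x) hle ?_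
    have : Continuous fun x : Fin d → ℂ => b * ‖x‖ := by fun_prop
    simpa using this.tendsto 0
  -- The unit sphere is empty when d = 0.
  rcases (Metric.sphere (0 : Fin d → ℂ) 1).eq_empty_or_nonempty with he | hne
  · refine ⟨1, one_pos, fun x => ?_⟩
    rcases eq_or_ne x 0 with rfl | hx
    · simp
    · have : ((‖x‖ : ℂ)⁻¹ • x) ∈ Metric.sphere (0 : Fin d → ℂ) 1 := by
        simp [norm_smul, hx]
      rw [he] at this
      exact this.elim
  · obtain ⟨y, hy, hmin⟩ := (isCompact_sphere (0 : Fin d → ℂ) 1).exists_isMinOn hne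
      hcont.continuousOn
    have hy0 : 0 < ν y := by
      refine lt_of_le_of_ne (apply_nonneg _ _) fun h => ?_
      rw [hν y h.symm] at hy
      simp at hy
    refine ⟨(ν y)⁻¹, inv_pos.mpr hy0, fun x => ?_⟩
    rcases eq_or_ne x 0 with rfl | hx
    · simp
    · have hx0 : 0 < ‖x‖ := norm_pos_iff.mpr hx
      have h1 : ν y ≤ ν ((‖x‖ : ℂ)⁻¹ • x) := hmin (by simp [norm_smul, hx])
      rw [map_smul_eq_mul, norm_inv, Complex.norm_real, norm_norm] at h1
      field_simp at h1 ⊢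
      linarith

theorem exists_norm_vecMul_le (M : Matrix (Fin d) (Fin d) ℂ) :
    ∃ c, 0 ≤ c ∧ ∀ x : Fin d → ℂ, ‖x ᵥ* M‖ ≤ c * ‖x‖ :=
  ⟨‖LinearMap.toContinuousLinearMap M.vecMulLinear‖, norm_nonneg _,
    fun x => (LinearMap.toContinuousLinearMap M.vecMulLinear).le_opNorm x⟩

theorem seminorm_vecMul_le_inducedNorm (ν : Seminorm ℂ (Fin d → ℂ)) (hν : ∀ x, ν x = 0 → x = 0)
    (M : Matrix (Fin d) (Fin d) ℂ) (x : Fin d → ℂ) : ν (x ᵥ* M) ≤ inducedNorm ν M * ν x := by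
  obtain ⟨b, hb, hle⟩ := exists_seminorm_le_norm ν
  obtain ⟨a, ha, hge⟩ := exists_norm_le_seminorm ν hν
  obtain ⟨c, hc, hM⟩ := exists_norm_vecMul_le M
  have hne : {c : ℝ | 0 ≤ c ∧ ∀ x : Fin d → ℂ, ν (x ᵥ* M) ≤ c * ν x}.Nonempty := by
    refine ⟨b * (c * a), by positivity, fun x => ?_⟩
    calc ν (x ᵥ* M) ≤ b * (c * ‖x‖) := (hle _).trans (by gcongr; exact hM x)
      _ ≤ b * (c * (a * ν x)) := by gcongr; exact hge x
      _ = _ := by ring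
  rcases eq_or_lt_of_le (apply_nonneg ν x) with h | h
  · rw [hν x h.symm]
    simp
  · rw [← div_le_iff₀ h]
    refine le_csInf hne fun c hc => ?_
    rw [div_le_iff₀ h]
    exact hc.2 x

theorem inducedNorm_nonneg (ν : Seminorm ℂ (Fin d → ℂ)) (M : Matrix (Fin d) (Fin d) ℂ) :
    0 ≤ inducedNorm ν M :=
  Real.sInf_nonneg fun _ hc => hc.1

theorem rhoAt_nonneg (ν : Seminorm ℂ (Fin d → ℂ)) (A : Fin q → Matrix (Fin d) (Fin d) ℂ) (ℓ : ℕ) :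
    0 ≤ rhoAt ν A ℓ :=
  Real.iSup_nonneg fun _ => Real.rpow_nonneg (inducedNorm_nonneg _ _) _

theorem seminorm_vecMul_prod_le_rhoAt (ν : Seminorm ℂ (Fin d → ℂ)) (hν : ∀ x, ν x = 0 → x = 0)
    (A : Fin q → Matrix (Fin d) (Fin d) ℂ) {ℓ : ℕ} (hℓ : 0 < ℓ) (l : List (Fin q))
    (hl : l.length = ℓ) (x : Fin d → ℂ) :
    ν (x ᵥ* (l.map A).prod) ≤ rhoAt ν A ℓ ^ ℓ * ν x := by
  subst hl
  have h1 : l.map A = List.ofFn fun i => A (l.get i) := by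
    rw [← List.ofFn_get (l.map A)]
    refine List.ext_get (by simp) fun n h1 h2 => by simp
  have h2 : inducedNorm ν (l.map A).prod ^ ((1 : ℝ) / (l.length : ℝ)) ≤ rhoAt ν A l.length := by
    rw [h1]
    exact le_ciSup (f := fun r : Fin l.length → Fin q =>
      inducedNorm ν (List.ofFn fun i => A (r i)).prod ^ ((1 : ℝ) / (l.length : ℝ)))
      (Set.finite_range _).bddAbove l.get
  refine (seminorm_vecMul_le_inducedNorm ν hν _ x).trans ?_
  gcongr
  have h3 : inducedNorm ν (l.map A).prod =
      (inducedNorm ν (l.map A).prod ^ ((1 : ℝ) / (l.length : ℝ))) ^ l.length := by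
    rw [one_div, Real.rpow_inv_natCast_pow (inducedNorm_nonneg _ _) hℓ.ne']
  rw [h3]
  exact pow_le_pow_left₀ (Real.rpow_nonneg (inducedNorm_nonneg _ _) _) h2 _

/-- A single block length is enough: either ρ_ℓ = ρ = R, or the infimum ρ < R is undercut by some
ρ_ℓ < R. -/
theorem exists_seminorm_prod_le_of_isAdmissibleRadius (ν : Seminorm ℂ (Fin d → ℂ))
    (hν : ∀ x, ν x = 0 → x = 0) (A : Fin q → Matrix (Fin d) (Fin d) ℂ) {R : ℝ}
    (hR : IsAdmissibleRadius ν A R) :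
    0 ≤ R ∧ ∃ ℓ, 0 < ℓ ∧ ∀ l : List (Fin q), l.length = ℓ → ∀ x,
      ν (x ᵥ* (l.map A).prod) ≤ R ^ ℓ * ν x := by
  have hρ : 0 ≤ jointSpectralRadius ν A := Real.iInf_nonneg fun ℓ => rhoAt_nonneg ν A ℓ
  by_cases hfin : FinitenessProperty ν A
  · rw [hR.1 hfin]
    refine ⟨hρ, ?_⟩
    obtain ⟨ℓ, hℓ, h⟩ := hfin
    rw [h]
    exact ⟨ℓ, hℓ, seminorm_vecMul_prod_le_rhoAt ν hν A hℓ⟩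
  · obtain ⟨h, -⟩ := hR.2 hfin
    obtain ⟨ℓ, hℓ⟩ := exists_lt_of_ciInf_lt h
    refine ⟨hρ.trans h.le, ℓ, ℓ.pos, fun l hl x => ?_⟩
    refine (seminorm_vecMul_prod_le_rhoAt ν hν A ℓ.pos l hl x).trans ?_
    have := rhoAt_nonneg ν A ℓ
    gcongr

/-- All sufficiently long products of the matrices `A_r` are bounded by `c R ^ n`. -/
def ProductsBounded (A : Fin q → Matrix (Fin d) (Fin d) ℂ) (R : ℝ) : Prop :=
  ∃ (c : ℝ) (n₀ : ℕ), 0 ≤ c ∧ (0 < R → n₀ = 0) ∧ ∀ l : List (Fin q), n₀ ≤ l.length →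
    ∀ x : Fin d → ℂ, ‖x ᵥ* (l.map A).prod‖ ≤ c * R ^ l.length * ‖x‖

theorem productsBounded_of_isAdmissibleRadius (ν : Seminorm ℂ (Fin d → ℂ))
    (hν : ∀ x, ν x = 0 → x = 0) (A : Fin q → Matrix (Fin d) (Fin d) ℂ) {R : ℝ}
    (hR : IsAdmissibleRadius ν A R) : 0 ≤ R ∧ ProductsBounded A R := by
  obtain ⟨hR0, ℓ, hℓ, hprod⟩ := exists_seminorm_prod_le_of_isAdmissibleRadius ν hν A hR
  refine ⟨hR0, ?_⟩
  obtain ⟨b, hb, hle⟩ := exists_seminorm_le_norm ν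
  obtain ⟨a, ha, hge⟩ := exists_norm_le_seminorm ν hν
  set D := 1 + ∑ r, inducedNorm ν (A r) with hD
  have hD1 : 1 ≤ D := by
    have : 0 ≤ ∑ r, inducedNorm ν (A r) := Finset.sum_nonneg fun r _ => inducedNorm_nonneg _ _
    linarith
  have hAD : ∀ r x, ν (x ᵥ* A r) ≤ D * ν x := fun r x => by
    refine (seminorm_vecMul_le_inducedNorm ν hν _ x).trans ?_
    gcongr
    have := Finset.single_le_sum (f := fun r => inducedNorm ν (A r))
      (fun r _ => inducedNorm_nonneg _ _) (Finset.mem_univ r)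
    linarith
  have hshort : ∀ (l : List (Fin q)) x, ν (x ᵥ* (l.map A).prod) ≤ D ^ l.length * ν x := by
    intro l
    induction l with
    | nil => simp
    | cons r l ih =>
      intro x
      rw [List.map_cons, List.prod_cons, ← vecMul_vecMul, List.length_cons, pow_succ, mul_assoc]
      refine (ih _).trans ?_
      gcongr
      exact hAD r x
  -- Blocks of length ℓ contribute R^ℓ each; every leftover factor contributes at most D.
  have hlong : ∀ (k : ℕ) (l : List (Fin q)) x, k * ℓ ≤ l.length →
      ν (x ᵥ* (l.map A).prod) ≤ R ^ (k * ℓ) * D ^ (l.length - k * ℓ) * ν x := by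
    intro k
    induction k with
    | zero => intro l x _; simpa using hshort l x
    | succ k ih =>
      intro l x hl
      rw [add_mul, one_mul] at hl
      have h1 := ih (l.drop ℓ) (x ᵥ* ((l.take ℓ).map A).prod)
        (by rw [List.length_drop]; omega)
      have h2 := hprod (l.take ℓ) (by rw [List.length_take]; omega) x
      rw [vecMul_vecMul, ← List.prod_append, ← List.map_append, List.take_append_drop,
        List.length_drop] at h1
      refine h1.trans ?_
      rw [add_mul, one_mul, pow_add, show l.length - (k * ℓ + ℓ) = l.length - ℓ - k * ℓ by omega]
      calc _ ≤ R ^ (k * ℓ) * D ^ (l.length - ℓ - k * ℓ) * (R ^ ℓ * ν x) := by gcongr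
        _ = _ := by ring
  rcases eq_or_lt_of_le hR0 with hR0 | hR0
  -- For R = 0 one block already annihilates every vector, hence the threshold ℓ.
  · refine ⟨0, ℓ, le_rfl, fun h => absurd hR0 h.ne, fun l hl x => ?_⟩
    have h1 := hlong 1 l x (by omega)
    rw [one_mul, ← hR0, zero_pow hℓ.ne', zero_mul, zero_mul] at h1
    rw [hν _ (le_antisymm h1 (apply_nonneg _ _))]
    simp
  -- Fewer than ℓ factors are left over, each exceeding R by a factor of at most max(1, D/R); a and
  -- b convert between the norms.
  · refine ⟨a * ((max 1 (D / R)) ^ ℓ * b), 0, by positivity, fun _ => rfl, fun l _ x => ?_⟩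
    have h1 := hlong (l.length / ℓ) l x (Nat.div_mul_le_self _ _)
    have hmod : l.length - l.length / ℓ * ℓ = l.length % ℓ := by
      have := Nat.div_add_mod' l.length ℓ
      omega
    rw [hmod] at h1
    have h2 : R ^ (l.length / ℓ * ℓ) * D ^ (l.length % ℓ) ≤
        R ^ l.length * (max 1 (D / R)) ^ ℓ := by
      conv_rhs => rw [← Nat.div_add_mod' l.length ℓ, pow_add, mul_assoc]
      gcongr
      calc D ^ (l.length % ℓ) = R ^ (l.length % ℓ) * (D / R) ^ (l.length % ℓ) := by
            rw [← mul_pow, mul_div_cancel₀ _ hR0.ne']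
        _ ≤ R ^ (l.length % ℓ) * (max 1 (D / R)) ^ (l.length % ℓ) := by
            gcongr
            exact le_max_right _ _
        _ ≤ _ := by
            gcongr
            · exact le_max_left _ _
            · exact (Nat.mod_lt _ hℓ).le
    calc _ ≤ a * ν (x ᵥ* (l.map A).prod) := hge _
      _ ≤ a * (R ^ l.length * (max 1 (D / R)) ^ ℓ * (b * ‖x‖)) := by
          gcongr
          exact h1.trans (by gcongr; exact hle x)
      _ = _ := by ring

/-! ### Digit products and the recursion for the summatory function -/

theorem seqF_eq_prod (hq : 2 ≤ q) (A : Fin q → Matrix (Fin d) (Fin d) ℂ) (k N : ℕ)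
    (h1 : q ^ k ≤ N) (h2 : N < q ^ (k + 1)) :
    ∃ l : List (Fin q), l.length = k + 1 ∧ seqF hq A N = (l.map A).prod := by
  induction k generalizing N with
  | zero =>
    rw [pow_zero] at h1
    rw [zero_add, pow_one] at h2
    refine ⟨[⟨N, h2⟩], rfl, ?_⟩
    have := seqF_mul_add hq A 0 ⟨N, h2⟩ (by simp; omega)
    simpa [seqF_zero] using this
  | succ k ih =>
    obtain ⟨l, hl, hf⟩ := ih (N / q)
      ((Nat.le_div_iff_mul_le (by omega)).mpr (by rwa [← pow_succ]))
      ((Nat.div_lt_iff_lt_mul (by omega)).mpr (by rwa [← pow_succ]))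
    refine ⟨⟨N % q, Nat.mod_lt _ (by omega)⟩ :: l, by simp [hl], ?_⟩
    have hN : q * (N / q) + N % q = N := Nat.div_add_mod N q
    have hN0 : N ≠ 0 := by
      have : 0 < q ^ (k + 1) := by positivity
      omega
    have := seqF_mul_add hq A (N / q) ⟨N % q, Nat.mod_lt _ (by omega)⟩ (by
      simpa only [hN] using hN0)
    simp only [hN] at this
    rw [this, hf, List.map_cons, List.prod_cons]

theorem ProductsBounded.exists_norm_seqF_le {A : Fin q → Matrix (Fin d) (Fin d) ℂ} {R : ℝ}
    (hq : 2 ≤ q) (hR : 0 ≤ R) (h : ProductsBounded A R) :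
    ∃ (c : ℝ) (n₀ : ℕ), 0 ≤ c ∧ (0 < R → n₀ = 0) ∧ ∀ N, 1 ≤ N → n₀ ≤ Nat.log q N →
      ∀ x : Fin d → ℂ, ‖x ᵥ* seqF hq A N‖ ≤ c * R ^ Nat.log q N * ‖x‖ := by
  obtain ⟨c, n₀, hc, hn, hb⟩ := h
  refine ⟨c * R, n₀, by positivity, hn, fun N hN hN₀ x => ?_⟩
  obtain ⟨l, hl, hf⟩ := seqF_eq_prod hq A (Nat.log q N) N (Nat.pow_log_le_self q (by omega))
    (Nat.lt_pow_succ_log_self (by omega) N)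
  rw [hf]
  refine (hb l (by omega) x).trans (le_of_eq ?_)
  rw [hl, pow_succ]
  ring

theorem sumF_succ (hq : 2 ≤ q) (A : Fin q → Matrix (Fin d) (Fin d) ℂ) (N : ℕ) :
    sumF hq A (N + 1) = sumF hq A N + seqF hq A N := by
  rw [sumF, Finset.sum_range_succ, sumF]

/-- Summing over the last digit turns f(qn + r) = A_r f(n) into C F(N). The one exception is n = r =
0, where I stands in place of A_0; this leaves I - A_0. -/
theorem sumF_mul (hq : 2 ≤ q) (A : Fin q → Matrix (Fin d) (Fin d) ℂ) {N : ℕ} (hN : 1 ≤ N) :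
    sumF hq A (q * N) = matC A * sumF hq A N + (1 - matA0 hq A) := by
  have h1 : ∀ M, sumF hq A (q * M + q) =
      sumF hq A (q * M) + ∑ r : Fin q, seqF hq A (q * M + r) := fun M => by
    rw [sumF, Finset.sum_range_add, Finset.sum_range (n := q), sumF]
  induction N, hN using Nat.le_induction with
  | base =>
    have h2 := h1 0
    rw [mul_zero, zero_add] at h2
    have h3 : ∀ r : Fin q, seqF hq A (0 + r) =
        A r + if r = ⟨0, by omega⟩ then 1 - matA0 hq A else 0 := by
      intro r
      split_ifs with h
      · rw [h]
        simp [seqF_zero, matA0]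
      · have := seqF_mul_add hq A 0 r (by
          rw [mul_zero, zero_add]
          exact fun h0 => h (Fin.ext h0))
        rw [mul_zero, seqF_zero, mul_one] at this
        rw [this, add_zero]
    rw [mul_one, h2, Finset.sum_congr rfl fun r _ => h3 r, Finset.sum_add_distrib]
    simp [sumF, matC, seqF_zero]
  | succ N hN ih =>
    have hq0 : 0 < q * N := Nat.mul_pos (by omega) hN
    rw [mul_add, mul_one, h1, ih, sumF_succ, mul_add,
      Finset.sum_congr rfl fun r _ => seqF_mul_add hq A N r (by omega), ← Finset.sum_mul, ← matC]
    abel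

/-! ### The spectral projection and the matrices K and ϑ -/

theorem IsJordanForm.isUnit_diagonal_mul_add {J : Matrix (Fin d) (Fin d) ℂ} (hJ : IsJordanForm J)
    {a b : Fin d → ℂ} (h : ∀ i, a i * J i i + b i ≠ 0) :
    IsUnit (diagonal a * J + diagonal b) := by
  have htri : (diagonal a * J + diagonal b).BlockTriangular id := by
    intro i j hij
    have hij' : (j : ℕ) < i := hij
    rw [Matrix.add_apply, diagonal_mul, hJ.off_diag i j (by omega) (by omega), 
      diagonal_apply_ne _ (show i ≠ j from fun h => by rw [h] at hij'; omega)]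
    simp
  rw [isUnit_iff_isUnit_det, det_of_isUpperTriangular htri, isUnit_iff_ne_zero,
    Finset.prod_ne_zero_iff]
  intro i _
  rw [Matrix.add_apply, diagonal_mul, diagonal_apply_eq]
  exact h i

theorem matD_mul_matD (A : Fin q → Matrix (Fin d) (Fin d) ℂ) (T : Matrix (Fin d) (Fin d) ℂ) :
    matD A T * matD A T = matD A T := by
  classical
  rw [matD, diagonal_mul_diagonal]
  congr 1
  funext i
  split_ifs <;> simp

/-- A nonzero superdiagonal entry joins equal diagonal entries of J, so D takes the same value at
both ends. -/
theorem matD_mul_matJ {A : Fin q → Matrix (Fin d) (Fin d) ℂ} {T : Matrix (Fin d) (Fin d) ℂ}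
    (hJ : IsJordanForm (matJ A T)) : matD A T * matJ A T = matJ A T * matD A T := by
  classical
  ext i j
  rw [matD, diagonal_mul, mul_diagonal]
  by_cases h1 : (j : ℕ) = i
  · rw [Fin.ext h1, mul_comm]
  · by_cases h2 : (j : ℕ) = i + 1
    · rcases hJ.super_diag i j h2 with h | ⟨h, h'⟩
      · rw [h, zero_mul, mul_zero]
      · rw [h', mul_comm]
    · rw [hJ.off_diag i j h1 h2, zero_mul, mul_zero]

/-- The projection `T⁻¹ D T` along the generalised eigenspace of `C` for the eigenvalue `1`. -/
def projD (A : Fin q → Matrix (Fin d) (Fin d) ℂ) (T : Matrix (Fin d) (Fin d) ℂ) :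
    Matrix (Fin d) (Fin d) ℂ :=
  T⁻¹ * matD A T * T

section

variable {A : Fin q → Matrix (Fin d) (Fin d) ℂ} {T : Matrix (Fin d) (Fin d) ℂ}

theorem conj_mul_conj (hT : IsUnit T) (M N : Matrix (Fin d) (Fin d) ℂ) :
    T⁻¹ * M * T * (T⁻¹ * N * T) = T⁻¹ * (M * N) * T := by
  have h := mul_nonsing_inv T ((isUnit_iff_isUnit_det T).mp hT)
  calc _ = T⁻¹ * M * (T * T⁻¹) * N * T := by simp only [mul_assoc]
    _ = _ := by rw [h]; simp only [mul_assoc, one_mul]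

theorem isUnit_conj (hT : IsUnit T) {M : Matrix (Fin d) (Fin d) ℂ} (hM : IsUnit M) :
    IsUnit (T⁻¹ * M * T) :=
  ((isUnit_nonsing_inv_iff.mpr hT).mul hM).mul hT

theorem conj_matJ (hT : IsUnit T) : T⁻¹ * matJ A T * T = matC A := by
  have h := nonsing_inv_mul T ((isUnit_iff_isUnit_det T).mp hT)
  calc _ = (T⁻¹ * T) * matC A * (T⁻¹ * T) := by simp only [matJ, mul_assoc]
    _ = _ := by rw [h, one_mul, mul_one]

theorem conj_one (hT : IsUnit T) : T⁻¹ * (1 : Matrix (Fin d) (Fin d) ℂ) * T = 1 := by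
  rw [mul_one, nonsing_inv_mul T ((isUnit_iff_isUnit_det T).mp hT)]

theorem projD_mul_projD (hT : IsUnit T) : projD A T * projD A T = projD A T := by
  rw [projD, conj_mul_conj hT, matD_mul_matD]

theorem projD_mul_matC (hT : IsUnit T) (hJ : IsJordanForm (matJ A T)) :
    projD A T * matC A = matC A * projD A T := by
  conv_lhs => rw [← conj_matJ (A := A) hT]
  conv_rhs => rw [← conj_matJ (A := A) hT]
  rw [projD, conj_mul_conj hT, conj_mul_conj hT, matD_mul_matJ hJ]

theorem matC'_eq (hT : IsUnit T) : matC' A T = projD A T * matC A := by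
  rw [← conj_matJ (A := A) hT, projD, conj_mul_conj hT, matC']
  simp only [mul_assoc]

theorem isUnit_one_sub_matC' (hT : IsUnit T) (hJ : IsJordanForm (matJ A T)) :
    IsUnit (1 - matC' A T) := by
  classical
  have h : 1 - matC' A T = T⁻¹ * (diagonal (fun i => -(if matJ A T i i = 1 then (0 : ℂ) else 1)) *
      matJ A T + diagonal fun _ => 1) * T := by
    rw [diagonal_one, mul_add, add_mul, conj_one hT, ← diagonal_neg, neg_mul, mul_neg, neg_mul,
      neg_add_eq_sub, matC', matD]
    simp only [mul_assoc]
  rw [h]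
  refine isUnit_conj hT (hJ.isUnit_diagonal_mul_add fun i => ?_)
  split_ifs with h1
  · simp
  · rw [neg_one_mul, neg_add_eq_sub]
    exact sub_ne_zero.mpr (Ne.symm h1)

/-- With P = `projD A T`, the identities PC = CP and C' = PC give (1 - C)P = P(1 - C'), and P(1 -
C') cancels the inverse in K. -/
theorem matK_eq (hq : 2 ≤ q) (hT : IsUnit T) (hJ : IsJordanForm (matJ A T)) :
    matK hq A T = matC A * matK hq A T + projD A T * (1 - matA0 hq A) := by
  have hu := mul_nonsing_inv _ ((isUnit_iff_isUnit_det _).mp (isUnit_one_sub_matC' hT hJ))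
  have h1 : matK hq A T = projD A T * (1 - matC' A T)⁻¹ * (1 - matA0 hq A) := rfl
  have h2 : (1 - matC A) * projD A T = projD A T * (1 - matC' A T) := by
    rw [matC'_eq hT, sub_mul, mul_sub, ← mul_assoc, projD_mul_projD hT, projD_mul_matC hT hJ,
      one_mul, mul_one]
  have h3 : (1 - matC A) * matK hq A T = projD A T * (1 - matA0 hq A) := by
    rw [h1, ← mul_assoc, ← mul_assoc, h2, mul_assoc (projD A T), hu, mul_one]
  rw [← h3, sub_mul, one_mul]
  abel

/-- The matrix QN + (1 - Q) acts as N on the range of Q and as the identity on the complement. Its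
invertibility makes N invertible on that range, so no nonzero vector there is killed by a power of
N. -/
theorem vecMul_eq_zero_of_isUnit_mul_add {Q N : Matrix (Fin d) (Fin d) ℂ} (hQ : Q * Q = Q)
    (hQN : Q * N = N * Q) (hM : IsUnit (Q * N + (1 - Q))) {w : Fin d → ℂ} {m : ℕ}
    (hw : w ᵥ* N ^ m = 0) : w ᵥ* Q = 0 := by
  have h1 : Q * (Q * N + (1 - Q)) = Q * N := by
    rw [mul_add, mul_sub, mul_one, hQ, sub_self, add_zero, ← mul_assoc, hQ]
  have h2 : ∀ k, Q * (Q * N + (1 - Q)) ^ k = Q * N ^ k := by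
    intro k
    induction k with
    | zero => simp
    | succ k ih =>
      have hk : Q * N ^ k = N ^ k * Q := Commute.pow_right hQN k
      rw [pow_succ, ← mul_assoc, ih, hk, mul_assoc, h1, ← mul_assoc, ← hk, mul_assoc, ← pow_succ]
  have h3 : (w ᵥ* Q) ᵥ* (Q * N + (1 - Q)) ^ m = 0 := by
    rw [vecMul_vecMul, h2, (Commute.pow_right hQN m : Q * N ^ m = N ^ m * Q), ← vecMul_vecMul, hw,
      zero_vecMul]
  have hu := mul_nonsing_inv _ ((isUnit_iff_isUnit_det _).mp (hM.pow m))
  rw [← vecMul_one (w ᵥ* Q), ← hu, ← vecMul_vecMul, h3, zero_vecMul]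

theorem vecMul_projD_of_eq_one (hT : IsUnit T) (hJ : IsJordanForm (matJ A T)) {w : Fin d → ℂ}
    {m : ℕ} (hw : w ᵥ* (matC A - 1) ^ m = 0) : w ᵥ* projD A T = 0 := by
  classical
  refine vecMul_eq_zero_of_isUnit_mul_add (projD_mul_projD hT)
    (by rw [mul_sub, sub_mul, projD_mul_matC hT hJ, one_mul, mul_one]) ?_ hw
  set δ : Fin d → ℂ := fun i => if matJ A T i i = 1 then 0 else 1 with hδ
  have hD : matD A T = diagonal δ := rfl
  -- In Jordan coordinates the diagonal is 1 where J has the entry 1, and J_ii - 1 elsewhere.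
  have h : projD A T * (matC A - 1) + (1 - projD A T) =
      T⁻¹ * (diagonal δ * matJ A T + diagonal fun i => 1 - 2 * δ i) * T := by
    have h2 : diagonal (fun i => 1 - 2 * δ i) = 1 - matD A T - matD A T := by
      rw [hD, ← diagonal_one, diagonal_sub, diagonal_sub]
      congr 1
      funext i
      ring
    rw [h2, ← hD, mul_add, add_mul, mul_sub T⁻¹, mul_sub T⁻¹, sub_mul _ _ T, sub_mul _ _ T,
      conj_one hT, ← conj_mul_conj hT, conj_matJ hT, ← projD, mul_sub, mul_one]
    abel
  rw [h]
  refine isUnit_conj hT (hJ.isUnit_diagonal_mul_add fun i => ?_)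
  by_cases h1 : matJ A T i i = 1
  · simp [hδ, h1]
  · simp only [hδ, h1, if_false]
    intro h2
    exact h1 (by linear_combination h2)

theorem vecMul_projD_of_ne_one (hT : IsUnit T) (hJ : IsJordanForm (matJ A T)) {lam : ℂ}
    (hlam : lam ≠ 1) {w : Fin d → ℂ} {m : ℕ}
    (hw : w ᵥ* (matC A - lam • (1 : Matrix (Fin d) (Fin d) ℂ)) ^ m = 0) :
    w ᵥ* projD A T = w := by
  classical
  have hP := projD_mul_projD (A := A) hT
  have hPC := projD_mul_matC hT hJ
  suffices h : w ᵥ* (1 - projD A T) = 0 by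
    rw [vecMul_sub, vecMul_one, sub_eq_zero] at h
    exact h.symm
  refine vecMul_eq_zero_of_isUnit_mul_add
    (by rw [mul_sub, sub_mul, sub_mul, hP]; simp)
    (by rw [sub_mul 1, one_mul, mul_sub _ 1, mul_one, mul_sub, sub_mul, hPC]; simp) ?_ hw
  set δ : Fin d → ℂ := fun i => if matJ A T i i = 1 then 0 else 1 with hδ
  have hD : matD A T = diagonal δ := rfl
  -- Here the diagonal is 1 - lam where J has the entry 1, and 1 elsewhere.
  have h : (1 - projD A T) * (matC A - lam • (1 : Matrix (Fin d) (Fin d) ℂ)) +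
        (1 - (1 - projD A T)) =
      T⁻¹ * (diagonal (fun i => 1 - δ i) * matJ A T +
        diagonal fun i => δ i - lam * (1 - δ i)) * T := by
    have h1 : diagonal (fun i => 1 - δ i) = 1 - matD A T := by
      rw [hD, ← diagonal_one, diagonal_sub]
    have h2 : diagonal (fun i => δ i - lam * (1 - δ i)) = matD A T - lam • (1 - matD A T) := by
      rw [← h1, hD, ← diagonal_smul, diagonal_sub]
      rfl
    rw [h1, h2, mul_add, add_mul, ← conj_mul_conj hT, conj_matJ hT, mul_sub T⁻¹ (matD A T),
      sub_mul _ _ T, mul_smul_comm, smul_mul_assoc, mul_sub T⁻¹ 1, sub_mul _ _ T, conj_one hT,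
      ← projD, mul_sub, mul_smul_comm, mul_one]
    abel
  rw [h]
  refine isUnit_conj hT (hJ.isUnit_diagonal_mul_add fun i => ?_)
  by_cases h1 : matJ A T i i = 1
  · simp only [hδ, h1, if_true]
    intro h2
    exact hlam (by linear_combination -h2)
  · simp [hδ, h1]

theorem vecMul_matK_of_eq_one (hq : 2 ≤ q) (hT : IsUnit T) (hJ : IsJordanForm (matJ A T))
    {w : Fin d → ℂ} {m : ℕ} (hw : w ᵥ* (matC A - 1) ^ m = 0) : w ᵥ* matK hq A T = 0 := by
  have h1 : matK hq A T = projD A T * (1 - matC' A T)⁻¹ * (1 - matA0 hq A) := rfl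
  rw [h1, mul_assoc, ← vecMul_vecMul, vecMul_projD_of_eq_one hT hJ hw, zero_vecMul]

theorem theta_eq (hq : 2 ≤ q) (hT : IsUnit T) (m : ℕ) :
    theta hq A T m = (m.factorial : ℂ)⁻¹ •
      ((1 - projD A T) * ((matC A - 1) ^ (m - 1) * (1 - matA0 hq A))) := by
  rw [theta, mul_sub T⁻¹, sub_mul _ _ T, conj_one hT, ← projD, mul_assoc]

theorem vecMul_theta_of_ne_one (hq : 2 ≤ q) (hT : IsUnit T) (hJ : IsJordanForm (matJ A T)) {lam : ℂ}
    (hlam : lam ≠ 1) {w : Fin d → ℂ} {m : ℕ}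
    (hw : w ᵥ* (matC A - lam • (1 : Matrix (Fin d) (Fin d) ℂ)) ^ m = 0) :
    w ᵥ* theta hq A T m = 0 := by
  rw [theta_eq hq hT, vecMul_smul, ← vecMul_vecMul, vecMul_sub, vecMul_one,
    vecMul_projD_of_ne_one hT hJ hlam hw, sub_self, zero_vecMul, smul_zero]

theorem vecMul_theta_of_eq_one (hq : 2 ≤ q) (hT : IsUnit T) (hJ : IsJordanForm (matJ A T))
    {w : Fin d → ℂ} {m : ℕ} (hw : w ᵥ* (matC A - 1) ^ m = 0) :
    w ᵥ* theta hq A T m =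
      (m.factorial : ℂ)⁻¹ • w ᵥ* ((matC A - 1) ^ (m - 1) * (1 - matA0 hq A)) := by
  rw [theta_eq hq hT, vecMul_smul, ← vecMul_vecMul, vecMul_sub, vecMul_one,
    vecMul_projD_of_eq_one hT hJ hw, sub_zero]

theorem vecMul_matK_of_ne_one (hq : 2 ≤ q) (hT : IsUnit T) (hJ : IsJordanForm (matJ A T)) {lam : ℂ}
    (hlam : lam ≠ 1) {w : Fin d → ℂ} {m : ℕ}
    (hw : w ᵥ* (matC A - lam • (1 : Matrix (Fin d) (Fin d) ℂ)) ^ m = 0) :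
    w ᵥ* matK hq A T = (w ᵥ* matC A) ᵥ* matK hq A T + w ᵥ* (1 - matA0 hq A) := by
  conv_lhs => rw [matK_eq hq hT hJ, vecMul_add, ← vecMul_vecMul, ← vecMul_vecMul,
    vecMul_projD_of_ne_one hT hJ hlam hw]

end

/-! ### Generalised eigenvectors and the growth of w C^j -/

/-- Kernels of powers stabilise by the exponent d. This bound makes the later constants independent
of the rank. -/
theorem IsGenLeftEigenvector.le {M : Matrix (Fin d) (Fin d) ℂ} {lam : ℂ} {m : ℕ} {w : Fin d → ℂ}
    (h : IsGenLeftEigenvector M lam m w) : m ≤ d := by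
  by_contra hm
  set f : Module.End ℂ (Fin d → ℂ) :=
    (M - lam • (1 : Matrix (Fin d) (Fin d) ℂ)).vecMulLinear with hf
  have hpow : ∀ k x, (f ^ k) x = x ᵥ* (M - lam • (1 : Matrix (Fin d) (Fin d) ℂ)) ^ k := by
    intro k x
    induction k with
    | zero => simp
    | succ k ih => rw [pow_succ', Module.End.mul_apply, ih, pow_succ, ← vecMul_vecMul]; rfl
  have h1 : w ∈ LinearMap.ker (f ^ m) := by
    rw [LinearMap.mem_ker, hpow, h.vecMul_pow]
  have h2 := Module.End.ker_pow_le_ker_pow_finrank f m h1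
  rw [LinearMap.mem_ker, hpow, Module.finrank_fin_fun] at h2
  apply h.vecMul_pow_pred
  rw [← Nat.add_sub_cancel' (by omega : d ≤ m - 1), pow_add, ← vecMul_vecMul, h2, zero_vecMul]

theorem vecMul_pow_eq_zero_of_le {M : Matrix (Fin d) (Fin d) ℂ} {m n : ℕ} {w : Fin d → ℂ}
    (h : w ᵥ* M ^ m = 0) (hmn : m ≤ n) : w ᵥ* M ^ n = 0 := by
  rw [← Nat.add_sub_cancel' hmn, pow_add, ← vecMul_vecMul, h, zero_vecMul]

theorem IsGenLeftEigenvector.vecMul_pow_pred_vecMul {M : Matrix (Fin d) (Fin d) ℂ} {lam : ℂ} {m : ℕ}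
    {w : Fin d → ℂ} (h : IsGenLeftEigenvector M lam m w) :
    (w ᵥ* (M - lam • (1 : Matrix (Fin d) (Fin d) ℂ)) ^ (m - 1)) ᵥ* M =
      lam • w ᵥ* (M - lam • (1 : Matrix (Fin d) (Fin d) ℂ)) ^ (m - 1) := by
  have h1 := h.vecMul_pow
  rw [← Nat.sub_add_cancel h.one_le, pow_succ, ← vecMul_vecMul, vecMul_sub, sub_eq_zero,
    vecMul_smul, vecMul_one] at h1
  exact h1

theorem IsGenLeftEigenvector.mem_spectrum {M : Matrix (Fin d) (Fin d) ℂ} {lam : ℂ} {m : ℕ}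
    {w : Fin d → ℂ} (h : IsGenLeftEigenvector M lam m w) : lam ∈ spectrum ℂ M := by
  rw [spectrum.mem_iff, Algebra.algebraMap_eq_smul_one]
  intro hu
  have hv := h.vecMul_pow_pred_vecMul
  apply h.vecMul_pow_pred
  generalize w ᵥ* (M - lam • (1 : Matrix (Fin d) (Fin d) ℂ)) ^ (m - 1) = v at *
  have hm := mul_nonsing_inv _ ((isUnit_iff_isUnit_det _).mp hu)
  have h1 : v ᵥ* (lam • 1 - M) = 0 := by
    rw [vecMul_sub, hv, vecMul_smul, vecMul_one, sub_self]
  calc v = v ᵥ* ((lam • 1 - M) * (lam • 1 - M)⁻¹) := by rw [hm, vecMul_one]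
    _ = 0 := by rw [← vecMul_vecMul, h1, zero_vecMul]

theorem vecMul_pow_eq_sum (M : Matrix (Fin d) (Fin d) ℂ) (lam : ℂ) (w : Fin d → ℂ) (j : ℕ) :
    w ᵥ* M ^ j = ∑ k ∈ Finset.range (j + 1), (lam ^ (j - k) * (j.choose k : ℂ)) •
      w ᵥ* (M - lam • (1 : Matrix (Fin d) (Fin d) ℂ)) ^ k := by
  have hc : Commute (M - lam • (1 : Matrix (Fin d) (Fin d) ℂ)) (lam • 1) :=
    (Commute.one_right _).smul_right lam
  conv_lhs => rw [← sub_add_cancel M (lam • (1 : Matrix (Fin d) (Fin d) ℂ)), hc.add_pow]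
  rw [vecMul_sum]
  refine Finset.sum_congr rfl fun k _ => ?_
  rw [← vecMul_smul, smul_pow, one_pow, mul_smul_comm, mul_one, ← nsmul_eq_mul', mul_comm, mul_smul,
    Nat.cast_smul_eq_nsmul]

/-- Only the exponents k < d give nonzero vectors, so any geometric rate ε can be imposed at the
price of the constant. -/
theorem exists_norm_vecMul_sub_pow_le (M : Matrix (Fin d) (Fin d) ℂ) (lam : ℂ) {ε : ℝ}
    (hε : 0 < ε) : ∃ c, 0 ≤ c ∧ ∀ w : Fin d → ℂ,
      w ᵥ* (M - lam • (1 : Matrix (Fin d) (Fin d) ℂ)) ^ d = 0 → ∀ k,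
      ‖w ᵥ* (M - lam • (1 : Matrix (Fin d) (Fin d) ℂ)) ^ k‖ ≤ c * ε ^ k * ‖w‖ := by
  choose b hb hle using fun k : ℕ =>
    exists_norm_vecMul_le ((M - lam • (1 : Matrix (Fin d) (Fin d) ℂ)) ^ k)
  have hpos : ∀ k, 0 ≤ b k / ε ^ k := fun k => div_nonneg (hb k) (by positivity)
  refine ⟨∑ k ∈ Finset.range d, b k / ε ^ k, Finset.sum_nonneg fun k _ => hpos k,
    fun w hw k => ?_⟩
  have hs : 0 ≤ ∑ k ∈ Finset.range d, b k / ε ^ k := Finset.sum_nonneg fun k _ => hpos k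
  by_cases hk : k < d
  · refine (hle k w).trans ?_
    gcongr
    rw [← div_le_iff₀ (by positivity)]
    exact Finset.single_le_sum (f := fun k => b k / ε ^ k) (fun k _ => hpos k)
      (Finset.mem_range.mpr hk)
  · rw [vecMul_pow_eq_zero_of_le hw (by omega), norm_zero]
    positivity

/-- The choice ε = μ - ‖lam‖ makes the binomial sum collapse to (‖lam‖ + ε)^j = μ^j. -/
theorem exists_norm_vecMul_pow_le_geometric (M : Matrix (Fin d) (Fin d) ℂ) {lam : ℂ} {μ : ℝ}
    (hμ : ‖lam‖ < μ) : ∃ c, 0 ≤ c ∧ ∀ w : Fin d → ℂ,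
      w ᵥ* (M - lam • (1 : Matrix (Fin d) (Fin d) ℂ)) ^ d = 0 → ∀ j,
      ‖w ᵥ* M ^ j‖ ≤ c * μ ^ j * ‖w‖ := by
  obtain ⟨c, hc, h⟩ := exists_norm_vecMul_sub_pow_le M lam (sub_pos.mpr hμ)
  refine ⟨c, hc, fun w hw j => ?_⟩
  rw [vecMul_pow_eq_sum M lam]
  refine (norm_sum_le _ _).trans ?_
  have h1 : μ ^ j = ∑ k ∈ Finset.range (j + 1),
      (μ - ‖lam‖) ^ k * ‖lam‖ ^ (j - k) * (j.choose k : ℝ) := by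
    rw [← add_pow]
    congr 1
    ring
  rw [h1, Finset.mul_sum, Finset.sum_mul]
  refine Finset.sum_le_sum fun k _ => ?_
  rw [norm_smul, norm_mul, norm_pow, Complex.norm_natCast]
  calc _ ≤ ‖lam‖ ^ (j - k) * (j.choose k : ℝ) * (c * (μ - ‖lam‖) ^ k * ‖w‖) := by
        gcongr
        exact h w hw k
    _ = _ := by ring

/-- With ε = ‖lam‖ each binomial term carries ‖lam‖^j. At most m ≤ d of them survive, and their
binomial coefficients are at most (j + 1)^(m-1). -/
theorem exists_norm_vecMul_pow_le_polynomial (M : Matrix (Fin d) (Fin d) ℂ) {lam : ℂ}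
    (hlam : lam ≠ 0) : ∃ c, 0 ≤ c ∧ ∀ (w : Fin d → ℂ) (m : ℕ), m ≤ d →
      w ᵥ* (M - lam • (1 : Matrix (Fin d) (Fin d) ℂ)) ^ m = 0 → ∀ j : ℕ,
      ‖w ᵥ* M ^ j‖ ≤ c * (‖lam‖ ^ j * ((j : ℝ) + 1) ^ (m - 1)) * ‖w‖ := by
  obtain ⟨c, hc, h⟩ := exists_norm_vecMul_sub_pow_le M lam (norm_pos_iff.mpr hlam)
  refine ⟨d * c, by positivity, fun w m hm hw j => ?_⟩
  rw [vecMul_pow_eq_sum M lam]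
  refine (norm_sum_le _ _).trans ?_
  have hterm : ∀ k ∈ Finset.range (j + 1), ‖(lam ^ (j - k) * (j.choose k : ℂ)) •
      w ᵥ* (M - lam • (1 : Matrix (Fin d) (Fin d) ℂ)) ^ k‖ ≤
      if k < m then c * (‖lam‖ ^ j * ((j : ℝ) + 1) ^ (m - 1)) * ‖w‖ else 0 := by
    intro k hk
    rw [Finset.mem_range] at hk
    split_ifs with hkm
    · have h1 : (j.choose k : ℝ) ≤ ((j : ℝ) + 1) ^ (m - 1) := by
        calc (j.choose k : ℝ) ≤ ((j ^ k : ℕ) : ℝ) := by exact_mod_cast Nat.choose_le_pow j k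
          _ ≤ ((j : ℝ) + 1) ^ k := by push_cast; gcongr; linarith
          _ ≤ _ := pow_le_pow_right₀ (by linarith [j.cast_nonneg (α := ℝ)]) (by omega)
      rw [norm_smul, norm_mul, norm_pow, Complex.norm_natCast]
      calc _ ≤ ‖lam‖ ^ (j - k) * ((j : ℝ) + 1) ^ (m - 1) * (c * ‖lam‖ ^ k * ‖w‖) := by
            gcongr
            exact h w (vecMul_pow_eq_zero_of_le hw hm) k
        _ = c * (‖lam‖ ^ (j - k) * ‖lam‖ ^ k * ((j : ℝ) + 1) ^ (m - 1)) * ‖w‖ := by ring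
        _ = _ := by rw [← pow_add, Nat.sub_add_cancel (by omega)]
    · rw [vecMul_pow_eq_zero_of_le hw (by omega), smul_zero, norm_zero]
  refine (Finset.sum_le_sum hterm).trans ?_
  rw [← Finset.sum_filter, Finset.sum_const, nsmul_eq_mul]
  have hcard : ((Finset.range (j + 1)).filter (· < m)).card ≤ d := by
    refine (Finset.card_le_card (t := Finset.range m) fun k hk => ?_).trans (by simpa using hm)
    rw [Finset.mem_filter] at hk
    exact Finset.mem_range.mpr hk.2
  calc _ ≤ (d : ℝ) * (c * (‖lam‖ ^ j * ((j : ℝ) + 1) ^ (m - 1)) * ‖w‖) := by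
        gcongr
    _ = _ := by ring

/-- A truncated Neumann series: 1 - M = (1 - lam)(1 - B), where B = (M - lam)/(1 - lam) is nilpotent
on the vectors in question. -/
theorem exists_vecMul_mul_one_sub (M : Matrix (Fin d) (Fin d) ℂ) {lam : ℂ} (hlam : lam ≠ 1) :
    ∃ G : Matrix (Fin d) (Fin d) ℂ, Commute G M ∧ ∀ w : Fin d → ℂ,
      w ᵥ* (M - lam • (1 : Matrix (Fin d) (Fin d) ℂ)) ^ d = 0 → w ᵥ* (G * (1 - M)) = w := by
  set s := (1 - lam)⁻¹ with hs
  have hl : 1 - lam ≠ 0 := sub_ne_zero.mpr (Ne.symm hlam)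
  set B := s • (M - lam • (1 : Matrix (Fin d) (Fin d) ℂ)) with hB
  have hBM : Commute B M :=
    (((Commute.refl M).sub_left ((Commute.one_left M).smul_left lam))).smul_left s
  refine ⟨s • ∑ k ∈ Finset.range d, B ^ k,
    (Commute.sum_left _ _ _ fun k _ => hBM.pow_left k).smul_left s, fun w hw => ?_⟩
  have h1 : 1 - M = (1 - lam) • (1 - B) := by
    rw [hB, smul_sub, smul_smul, hs, mul_inv_cancel₀ hl, one_smul, sub_smul, one_smul]
    abel
  rw [h1, smul_mul_smul_comm, hs, inv_mul_cancel₀ hl, one_smul, geom_sum_mul_neg, vecMul_sub,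
    vecMul_one, hB, smul_pow, vecMul_smul, hw, smul_zero, sub_zero]

/-! ### Unrolling the recursion: eigenvalues of modulus at most R -/

/-- Each passage from N to N / q replaces w by wM; after j passages the new error is of size ‖w M^j‖
R^(ℓ-j). Invariance of S keeps the one-step estimate applicable. -/
theorem norm_vecMul_le_sum_of_recurrence (hq : 2 ≤ q) {X : ℕ → Matrix (Fin d) (Fin d) ℂ}
    {M : Matrix (Fin d) (Fin d) ℂ} {S : Set (Fin d → ℂ)} (hS : ∀ w ∈ S, w ᵥ* M ∈ S) {a R : ℝ}
    (h0 : ∀ w ∈ S, ∀ N, 1 ≤ N → N < q → ‖w ᵥ* X N‖ ≤ a * ‖w‖)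
    (h1 : ∀ w ∈ S, ∀ N, q ≤ N →
      ‖w ᵥ* X N - (w ᵥ* M) ᵥ* X (N / q)‖ ≤ a * R ^ Nat.log q N * ‖w‖) (ℓ : ℕ) :
    ∀ w ∈ S, ∀ N, 1 ≤ N → Nat.log q N = ℓ →
      ‖w ᵥ* X N‖ ≤ a * ∑ j ∈ Finset.range (ℓ + 1), ‖w ᵥ* M ^ j‖ * R ^ (ℓ - j) := by
  induction ℓ with
  | zero =>
    intro w hw N hN hl
    rw [Nat.log_eq_zero_iff] at hl
    simpa using h0 w hw N hN (by omega)
  | succ ℓ ih =>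
    intro w hw N hN hl
    have hqN : q ≤ N := by
      by_contra hlt
      rw [Nat.log_of_lt (by omega)] at hl
      omega
    have h2 := ih (w ᵥ* M) (hS w hw) (N / q) (Nat.div_pos hqN (by omega))
      (by rw [Nat.log_div_base, hl]; rfl)
    have h3 := h1 w hw N hqN
    rw [hl] at h3
    rw [Finset.sum_range_succ', mul_add]
    calc ‖w ᵥ* X N‖ = ‖(w ᵥ* M) ᵥ* X (N / q) + (w ᵥ* X N - (w ᵥ* M) ᵥ* X (N / q))‖ := by
          congr 1; abel
      _ ≤ _ := (norm_add_le _ _).trans (add_le_add h2 h3)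
      _ = _ := by
        congr 1
        · congr 1
          refine Finset.sum_congr rfl fun j _ => ?_
          rw [vecMul_vecMul, ← pow_succ', Nat.add_sub_add_right]
        · simp
          ring

theorem log_mul_add (hq : 2 ≤ q) {n i : ℕ} (hn : 1 ≤ n) (hi : i < q) :
    Nat.log q (q * n + i) = Nat.log q n + 1 := by
  have h : (q * n + i) / q = n := by
    rw [Nat.mul_add_div (by omega), Nat.div_eq_of_lt hi, add_zero]
  rw [Nat.log_of_one_lt_of_le (by omega) (by nlinarith), h]

theorem sumF_mul_add (hq : 2 ≤ q) (A : Fin q → Matrix (Fin d) (Fin d) ℂ) {n : ℕ} (hn : 1 ≤ n)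
    (r : ℕ) : sumF hq A (q * n + r) = matC A * sumF hq A n + (1 - matA0 hq A) +
      ∑ i ∈ Finset.range r, seqF hq A (q * n + i) := by
  rw [← sumF_mul hq A hn, sumF, Finset.sum_range_add, sumF]

/-- F(N) differs from F(q⌊N/q⌋) by fewer than q values of f, all at arguments with the same ⌊log_q⌋
as N. -/
theorem ProductsBounded.exists_norm_sumF_sub_le {A : Fin q → Matrix (Fin d) (Fin d) ℂ} {R : ℝ}
    (hq : 2 ≤ q) (hR : 0 ≤ R) (h : ProductsBounded A R) :
    ∃ (c : ℝ) (n₀ : ℕ), 0 ≤ c ∧ (0 < R → n₀ = 0) ∧ ∀ N, q ≤ N → n₀ ≤ Nat.log q N →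
      ∀ w : Fin d → ℂ, ‖w ᵥ* sumF hq A N -
        ((w ᵥ* matC A) ᵥ* sumF hq A (N / q) + w ᵥ* (1 - matA0 hq A))‖ ≤
          c * R ^ Nat.log q N * ‖w‖ := by
  obtain ⟨c, n₀, hc, hn, hf⟩ := h.exists_norm_seqF_le hq hR
  refine ⟨q * c, n₀, by positivity, hn, fun N hN hlog w => ?_⟩
  have hn1 : 1 ≤ N / q := Nat.div_pos hN (by omega)
  have hr : N % q < q := Nat.mod_lt _ (by omega)
  have hN' : q * (N / q) + N % q = N := Nat.div_add_mod N q
  have h1 := sumF_mul_add hq A hn1 (N % q)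
  rw [hN'] at h1
  rw [h1, vecMul_add, vecMul_add, vecMul_vecMul, add_sub_cancel_left, vecMul_sum]
  refine (norm_sum_le _ _).trans ?_
  have h2 : ∀ i ∈ Finset.range (N % q), ‖w ᵥ* seqF hq A (q * (N / q) + i)‖ ≤
      c * R ^ Nat.log q N * ‖w‖ := by
    intro i hi
    rw [Finset.mem_range] at hi
    have h3 : Nat.log q (q * (N / q) + i) = Nat.log q N := by
      conv_rhs => rw [← hN']
      rw [log_mul_add hq hn1 (by omega), log_mul_add hq hn1 hr]
    have := hf (q * (N / q) + i) (by nlinarith) (by rwa [h3]) w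
    rwa [h3] at this
  refine (Finset.sum_le_sum h2).trans ?_
  rw [Finset.sum_const, Finset.card_range, nsmul_eq_mul]
  calc _ ≤ (q : ℝ) * (c * R ^ Nat.log q N * ‖w‖) := by
        gcongr
    _ = _ := by ring

theorem vecMul_mem_of_vecMul_sub_pow {M : Matrix (Fin d) (Fin d) ℂ} {lam : ℂ} {m : ℕ}
    {B : Matrix (Fin d) (Fin d) ℂ} (hB : Commute B M) {w : Fin d → ℂ}
    (hw : w ᵥ* (M - lam • (1 : Matrix (Fin d) (Fin d) ℂ)) ^ m = 0) :
    (w ᵥ* B) ᵥ* (M - lam • (1 : Matrix (Fin d) (Fin d) ℂ)) ^ m = 0 := by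
  have h : Commute B ((M - lam • (1 : Matrix (Fin d) (Fin d) ℂ)) ^ m) :=
    (hB.sub_right ((Commute.one_right B).smul_right lam)).pow_right m
  rw [vecMul_vecMul, h.eq, ← vecMul_vecMul, hw, zero_vecMul]

/-- There is a matrix `K`, independent of the Jordan form, that describes `w K` for all generalised
eigenvectors `w` for an eigenvalue `lam ≠ 1`. -/
theorem exists_matK_independent (hq : 2 ≤ q) (A : Fin q → Matrix (Fin d) (Fin d) ℂ) {lam : ℂ}
    (hlam : lam ≠ 1) : ∃ K : Matrix (Fin d) (Fin d) ℂ, ∀ w : Fin d → ℂ,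
      w ᵥ* (matC A - lam • (1 : Matrix (Fin d) (Fin d) ℂ)) ^ d = 0 →
      w ᵥ* K = (w ᵥ* matC A) ᵥ* K + w ᵥ* (1 - matA0 hq A) ∧
      ∀ T : Matrix (Fin d) (Fin d) ℂ, IsUnit T → IsJordanForm (matJ A T) →
        w ᵥ* matK hq A T = w ᵥ* K := by
  obtain ⟨G, hGC, hG⟩ := exists_vecMul_mul_one_sub (matC A) hlam
  refine ⟨G * (1 - matA0 hq A), fun w hw => ⟨?_, fun T hT hJ => ?_⟩⟩
  · rw [← sub_eq_iff_eq_add', vecMul_vecMul, ← vecMul_sub, ← mul_assoc, ← sub_mul]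
    have h1 : G - matC A * G = G * (1 - matC A) := by rw [mul_sub, mul_one, hGC.eq]
    rw [h1, ← vecMul_vecMul, hG w hw]
  -- The vector wG is in the same generalised eigenspace, so w K_T = wG(1 - C) K_T = wG(1 - A_0),
  -- writing K_T for `matK hq A T`.
  · have h1 := vecMul_matK_of_ne_one hq hT hJ hlam (vecMul_mem_of_vecMul_sub_pow hGC hw)
    rw [← sub_eq_iff_eq_add', ← sub_vecMul, vecMul_vecMul, ← vecMul_sub, vecMul_vecMul] at h1
    have h2 : G - G * matC A = G * (1 - matC A) := by rw [mul_sub, mul_one]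
    rw [h2, ← vecMul_vecMul, hG w hw] at h1
    rw [h1, vecMul_vecMul]

/-- The bound of `w F(N) - w K` in terms of the growth of `w C ^ j`. -/
theorem exists_norm_sumF_sub_le_sum (hq : 2 ≤ q) (A : Fin q → Matrix (Fin d) (Fin d) ℂ) {R : ℝ}
    (hR : 0 < R) (hA : ProductsBounded A R) (lam : ℂ) (K : Matrix (Fin d) (Fin d) ℂ)
    (hK : (1 ≤ R ∧ K = 0) ∨ ∀ w : Fin d → ℂ,
      w ᵥ* (matC A - lam • (1 : Matrix (Fin d) (Fin d) ℂ)) ^ d = 0 →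
      w ᵥ* K = (w ᵥ* matC A) ᵥ* K + w ᵥ* (1 - matA0 hq A)) :
    ∃ a, 0 ≤ a ∧ ∀ w : Fin d → ℂ,
      w ᵥ* (matC A - lam • (1 : Matrix (Fin d) (Fin d) ℂ)) ^ d = 0 → ∀ N, 1 ≤ N →
      ‖w ᵥ* sumF hq A N - w ᵥ* K‖ ≤ a * ∑ j ∈ Finset.range (Nat.log q N + 1),
        ‖w ᵥ* matC A ^ j‖ * R ^ (Nat.log q N - j) := by
  obtain ⟨c, n₀, hc, hn₀, hF⟩ := hA.exists_norm_sumF_sub_le hq hR.le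
  rw [hn₀ hR] at hF
  choose b hb hle using fun N : ℕ => exists_norm_vecMul_le (sumF hq A N - K)
  obtain ⟨b₀, hb₀, hle₀⟩ := exists_norm_vecMul_le (1 - matA0 hq A)
  have hbs : 0 ≤ ∑ N ∈ Finset.range q, b N := Finset.sum_nonneg fun N _ => hb N
  set a := c + b₀ + ∑ N ∈ Finset.range q, b N with ha
  refine ⟨a, by positivity, fun w hw N hN => ?_⟩
  have key := norm_vecMul_le_sum_of_recurrence hq (X := fun N => sumF hq A N - K) (M := matC A)
    (S := {w | w ᵥ* (matC A - lam • (1 : Matrix (Fin d) (Fin d) ℂ)) ^ d = 0})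
    (fun w hw => vecMul_mem_of_vecMul_sub_pow (Commute.refl _) hw) (a := a) (R := R)
    (fun w _ N _ hNq => (hle N w).trans (by
      gcongr
      have := Finset.single_le_sum (f := b) (fun N _ => hb N) (Finset.mem_range.mpr hNq)
      linarith))
    (fun w hw N hN => by
      have h1 := hF N hN (Nat.zero_le _) w
      have hRl : 0 ≤ R ^ Nat.log q N := by positivity
      -- For R ≥ 1 the constant w(1 - A_0) is itself O(R^⌊log_q N⌋) and may join the error;
      -- otherwise K cancels it exactly.
      rcases hK with ⟨hR1, rfl⟩ | hK
      · have h2 : ‖w ᵥ* (1 - matA0 hq A)‖ ≤ b₀ * R ^ Nat.log q N * ‖w‖ := by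
          refine (hle₀ w).trans ?_
          gcongr
          exact le_mul_of_one_le_right hb₀ (one_le_pow₀ hR1)
        calc _ = ‖(w ᵥ* sumF hq A N - ((w ᵥ* matC A) ᵥ* sumF hq A (N / q) +
              w ᵥ* (1 - matA0 hq A))) + w ᵥ* (1 - matA0 hq A)‖ := by
              rw [sub_zero, sub_zero]
              congr 1
              abel
          _ ≤ c * R ^ Nat.log q N * ‖w‖ + b₀ * R ^ Nat.log q N * ‖w‖ :=
              (norm_add_le _ _).trans (add_le_add h1 h2)
          _ = (c + b₀) * R ^ Nat.log q N * ‖w‖ := by ring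
          _ ≤ _ := by
              gcongr
              linarith
      · have h2 := hK w hw
        calc _ = ‖w ᵥ* sumF hq A N - ((w ᵥ* matC A) ᵥ* sumF hq A (N / q) +
              w ᵥ* (1 - matA0 hq A))‖ := by
              simp only [vecMul_sub _ _ w, vecMul_sub _ _ (w ᵥ* matC A), h2]
              congr 1
              abel
          _ ≤ c * R ^ Nat.log q N * ‖w‖ := h1
          _ ≤ _ := by
              gcongr
              linarith)
    (Nat.log q N) w hw N hN rfl
  simpa only [vecMul_sub] using key

theorem sum_geometric_le {c μ R : ℝ} (hc : 0 ≤ c) (hμ : 0 ≤ μ) (hμR : μ < R) (ℓ : ℕ) :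
    ∑ j ∈ Finset.range (ℓ + 1), c * μ ^ j * R ^ (ℓ - j) ≤ c * (1 - μ / R)⁻¹ * R ^ ℓ := by
  have hR : 0 < R := hμ.trans_lt hμR
  have hr0 : 0 ≤ μ / R := by positivity
  have hr1 : μ / R < 1 := by rwa [div_lt_one hR]
  have h1 : ∀ j ∈ Finset.range (ℓ + 1), c * μ ^ j * R ^ (ℓ - j) = c * R ^ ℓ * (μ / R) ^ j := by
    intro j hj
    rw [Finset.mem_range] at hj
    rw [← Nat.sub_add_cancel (by omega : j ≤ ℓ), pow_add, div_pow, Nat.add_sub_cancel]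
    field_simp
  rw [Finset.sum_congr rfl h1, ← Finset.mul_sum, mul_right_comm c,
    ← tsum_geometric_of_lt_one hr0 hr1]
  gcongr
  exact (summable_geometric_of_lt_one hr0 hr1).sum_le_tsum _ fun i _ => by positivity

/-- A bound for `w ϑ_m` that does not depend on the Jordan form. -/
theorem exists_norm_vecMul_theta_le (hq : 2 ≤ q) (A : Fin q → Matrix (Fin d) (Fin d) ℂ) :
    ∃ c, 0 ≤ c ∧ ∀ T : Matrix (Fin d) (Fin d) ℂ, IsUnit T → IsJordanForm (matJ A T) →
      ∀ m ≤ d, ∀ w : Fin d → ℂ, w ᵥ* (matC A - 1) ^ m = 0 →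
      ‖w ᵥ* theta hq A T m‖ ≤ c * ‖w‖ := by
  choose b hb hle using fun m : ℕ => exists_norm_vecMul_le
    ((m.factorial : ℂ)⁻¹ • ((matC A - 1) ^ (m - 1) * (1 - matA0 hq A)))
  refine ⟨∑ m ∈ Finset.range (d + 1), b m, Finset.sum_nonneg fun m _ => hb m,
    fun T hT hJ m hm w hw => ?_⟩
  rw [vecMul_theta_of_eq_one hq hT hJ hw, ← vecMul_smul]
  refine (hle m w).trans ?_
  gcongr
  exact Finset.single_le_sum (f := b) (fun m _ => hb m) (Finset.mem_range.mpr (by omega))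

theorem logb_le_log_add_one (hq : 2 ≤ q) {N : ℕ} (hN : 1 ≤ N) :
    Real.logb q N ≤ (Nat.log q N : ℝ) + 1 := by
  have hq1 : (1 : ℝ) < q := by exact_mod_cast (by omega : 1 < q)
  rw [Real.logb_le_iff_le_rpow hq1 (by exact_mod_cast hN)]
  have := (Nat.lt_pow_succ_log_self (by omega : 1 < q) N).le
  rw [show ((Nat.log q N : ℝ) + 1) = ((Nat.log q N + 1 : ℕ) : ℝ) by push_cast; rfl,
    Real.rpow_natCast]
  exact_mod_cast this

theorem log_le_logb (hq : 2 ≤ q) {N : ℕ} (hN : 1 ≤ N) : (Nat.log q N : ℝ) ≤ Real.logb q N := by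
  have hq1 : (1 : ℝ) < q := by exact_mod_cast (by omega : 1 < q)
  rw [Real.le_logb_iff_rpow_le hq1 (by exact_mod_cast hN), Real.rpow_natCast]
  exact_mod_cast Nat.pow_log_le_self q (by omega)

theorem norm_mainTerm_sub_le (hq : 2 ≤ q) {A : Fin q → Matrix (Fin d) (Fin d) ℂ}
    {T : Matrix (Fin d) (Fin d) ℂ} (hT : IsUnit T) (hJ : IsJordanForm (matJ A T)) {c : ℝ}
    {m N : ℕ} {w : Fin d → ℂ} (hw : w ᵥ* (matC A - 1) ^ m = 0)
    (hθ : ‖w ᵥ* theta hq A T m‖ ≤ c * ‖w‖) (hN : 1 ≤ N) :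
    ‖w ᵥ* sumF hq A N - mainTerm hq A T m w N‖ ≤
      ‖w ᵥ* sumF hq A N‖ + ((Nat.log q N : ℝ) + 1) ^ m * (c * ‖w‖) := by
  have hl : 0 ≤ Real.logb q N :=
    Real.logb_nonneg (by exact_mod_cast (by omega : 1 < q)) (by exact_mod_cast hN)
  rw [mainTerm, vecMul_matK_of_eq_one hq hT hJ hw, zero_add]
  refine (norm_sub_le _ _).trans ?_
  rw [norm_smul, norm_pow, Complex.norm_real, Real.norm_of_nonneg hl]
  gcongr
  exact logb_le_log_add_one hq hN

theorem exists_error_le_of_norm_lt (hq : 2 ≤ q) (A : Fin q → Matrix (Fin d) (Fin d) ℂ) {R : ℝ}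
    (hR : 0 < R) (hA : ProductsBounded A R) {lam : ℂ} (hlam : ‖lam‖ < R) :
    ∃ c, 0 ≤ c ∧ ∀ T : Matrix (Fin d) (Fin d) ℂ, IsUnit T → IsJordanForm (matJ A T) →
      ∀ (m : ℕ) (w : Fin d → ℂ), IsGenLeftEigenvector (matC A) lam m w → ∀ N, 1 ≤ N →
      ‖w ᵥ* sumF hq A N - mainTerm hq A T m w N‖ ≤ c * R ^ Nat.log q N * ‖w‖ := by
  obtain ⟨μ, hμ1, hμ2⟩ := exists_between hlam
  have hμ0 : 0 ≤ μ := (norm_nonneg _).trans hμ1.le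
  obtain ⟨c, hc, hpow⟩ := exists_norm_vecMul_pow_le_geometric (matC A) hμ1
  have hr : 0 < 1 - μ / R := by
    have : μ / R < 1 := by rwa [div_lt_one hR]
    linarith
  have hsum : ∀ w : Fin d → ℂ,
      w ᵥ* (matC A - lam • (1 : Matrix (Fin d) (Fin d) ℂ)) ^ d = 0 → ∀ ℓ,
      ∑ j ∈ Finset.range (ℓ + 1), ‖w ᵥ* matC A ^ j‖ * R ^ (ℓ - j) ≤
        c * (1 - μ / R)⁻¹ * R ^ ℓ * ‖w‖ := by
    intro w hw ℓ
    calc _ ≤ ∑ j ∈ Finset.range (ℓ + 1), c * μ ^ j * R ^ (ℓ - j) * ‖w‖ := by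
          refine Finset.sum_le_sum fun j _ => ?_
          rw [mul_right_comm]
          gcongr
          exact hpow w hw j
      _ ≤ _ := by
          rw [← Finset.sum_mul]
          gcongr
          exact sum_geometric_le hc hμ0 hμ2 ℓ
  by_cases h1 : lam = 1
  · subst h1
    have hR1 : 1 < R := by simpa using hlam
    obtain ⟨a, ha, hX⟩ := exists_norm_sumF_sub_le_sum hq A hR hA 1 0 (Or.inl ⟨hR1.le, rfl⟩)
    obtain ⟨b, hb, hθ⟩ := exists_norm_vecMul_theta_le hq A
    have hlogR := Real.log_pos hR1
    refine ⟨a * (c * (1 - μ / R)⁻¹) + (d.factorial / Real.log R ^ d) * R * b, by positivity,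
      fun T hT hJ m w hw N hN => ?_⟩
    have hwm := hw.vecMul_pow
    have h2 := hX w (vecMul_pow_eq_zero_of_le hwm hw.le) N hN
    rw [vecMul_zero, sub_zero] at h2
    have h3 := hsum w (vecMul_pow_eq_zero_of_le hwm hw.le) (Nat.log q N)
    rw [one_smul] at hwm
    have h4 := norm_mainTerm_sub_le hq hT hJ hwm (hθ T hT hJ m hw.le w hwm) hN
    -- For lam = 1 one has R > 1, so the term (log_q N)^m wϑ_m is smaller than the permitted error;
    -- m ≤ d makes the constant uniform.
    have h5 : ((Nat.log q N : ℝ) + 1) ^ m ≤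
        (d.factorial / Real.log R ^ d) * (R ^ Nat.log q N * R) := by
      have hl : (1 : ℝ) ≤ (Nat.log q N : ℝ) + 1 := by
        linarith [(Nat.log q N).cast_nonneg (α := ℝ)]
      refine (pow_le_pow_right₀ hl hw.le).trans ((pow_le_mul_exp d hlogR (by linarith)).trans ?_)
      gcongr
      rw [← Real.rpow_def_of_pos hR, Real.rpow_add_one hR.ne', Real.rpow_natCast]
    calc _ ≤ a * (c * (1 - μ / R)⁻¹ * R ^ Nat.log q N * ‖w‖) +
          (d.factorial / Real.log R ^ d) * (R ^ Nat.log q N * R) * (b * ‖w‖) := by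
          refine h4.trans (add_le_add (h2.trans ?_) ?_) <;> gcongr
      _ = _ := by ring
  · obtain ⟨K, hK⟩ := exists_matK_independent hq A h1
    obtain ⟨a, ha, hX⟩ := exists_norm_sumF_sub_le_sum hq A hR hA lam K
      (Or.inr fun w hw => (hK w hw).1)
    refine ⟨a * (c * (1 - μ / R)⁻¹), by positivity, fun T hT hJ m w hw N hN => ?_⟩
    have hwd := vecMul_pow_eq_zero_of_le hw.vecMul_pow hw.le
    rw [mainTerm, vecMul_theta_of_ne_one hq hT hJ h1 hw.vecMul_pow, smul_zero, add_zero,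
      (hK w hwd).2 T hT hJ]
    refine (hX w hwd N hN).trans ?_
    calc _ ≤ a * (c * (1 - μ / R)⁻¹ * R ^ Nat.log q N * ‖w‖) := by
          gcongr
          exact hsum w hwd _
      _ = _ := by ring

theorem exists_error_le_of_norm_eq (hq : 2 ≤ q) (A : Fin q → Matrix (Fin d) (Fin d) ℂ) {R : ℝ}
    (hR : 0 < R) (hA : ProductsBounded A R) {lam : ℂ} (hlam : ‖lam‖ = R) :
    ∃ c, 0 ≤ c ∧ ∀ T : Matrix (Fin d) (Fin d) ℂ, IsUnit T → IsJordanForm (matJ A T) →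
      ∀ (m : ℕ) (w : Fin d → ℂ), IsGenLeftEigenvector (matC A) lam m w → ∀ N, 1 ≤ N →
      ‖w ᵥ* sumF hq A N - mainTerm hq A T m w N‖ ≤
        c * (R ^ Nat.log q N * ((Nat.log q N : ℝ) + 1) ^ m) * ‖w‖ := by
  have hl0 : lam ≠ 0 := norm_pos_iff.mp (by rwa [hlam])
  obtain ⟨c, hc, hpow⟩ := exists_norm_vecMul_pow_le_polynomial (matC A) hl0
  rw [hlam] at hpow
  have hsum : ∀ m (w : Fin d → ℂ), IsGenLeftEigenvector (matC A) lam m w → ∀ ℓ : ℕ,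
      ∑ j ∈ Finset.range (ℓ + 1), ‖w ᵥ* matC A ^ j‖ * R ^ (ℓ - j) ≤
        c * (R ^ ℓ * ((ℓ : ℝ) + 1) ^ m) * ‖w‖ := by
    intro m w hw ℓ
    have hterm : ∀ j ∈ Finset.range (ℓ + 1), ‖w ᵥ* matC A ^ j‖ * R ^ (ℓ - j) ≤
        c * (R ^ ℓ * ((ℓ : ℝ) + 1) ^ (m - 1)) * ‖w‖ := by
      intro j hj
      have hj' : j ≤ ℓ := Nat.lt_succ_iff.mp (Finset.mem_range.mp hj)
      calc _ ≤ c * (R ^ j * ((ℓ : ℝ) + 1) ^ (m - 1)) * ‖w‖ * R ^ (ℓ - j) := by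
            gcongr
            refine (hpow w m hw.le hw.vecMul_pow j).trans ?_
            gcongr
        _ = c * ((R ^ j * R ^ (ℓ - j)) * ((ℓ : ℝ) + 1) ^ (m - 1)) * ‖w‖ := by ring
        _ = _ := by rw [← pow_add, Nat.add_sub_cancel' hj']
    -- The sum has ℓ + 1 terms of the same bound, which raises the exponent from m - 1 to m.
    refine (Finset.sum_le_sum hterm).trans (le_of_eq ?_)
    rw [Finset.sum_const, Finset.card_range, nsmul_eq_mul]
    conv_rhs => rw [← Nat.sub_add_cancel hw.one_le, pow_succ]
    push_cast
    ring
  by_cases h1 : lam = 1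
  · subst h1
    have hR1 : R = 1 := by simpa using hlam.symm
    subst hR1
    obtain ⟨a, ha, hX⟩ := exists_norm_sumF_sub_le_sum hq A hR hA 1 0 (Or.inl ⟨le_rfl, rfl⟩)
    obtain ⟨b, hb, hθ⟩ := exists_norm_vecMul_theta_le hq A
    refine ⟨a * c + b, by positivity, fun T hT hJ m w hw N hN => ?_⟩
    have hwm := hw.vecMul_pow
    have h2 := hX w (vecMul_pow_eq_zero_of_le hwm hw.le) N hN
    rw [vecMul_zero, sub_zero] at h2
    have h3 := mul_le_mul_of_nonneg_left (hsum m w hw (Nat.log q N)) ha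
    rw [one_smul] at hwm
    have h4 := norm_mainTerm_sub_le hq hT hJ hwm (hθ T hT hJ m hw.le w hwm) hN
    refine h4.trans ((add_le_add_left (h2.trans h3) _).trans (le_of_eq ?_))
    rw [one_pow]
    ring
  · obtain ⟨K, hK⟩ := exists_matK_independent hq A h1
    obtain ⟨a, ha, hX⟩ := exists_norm_sumF_sub_le_sum hq A hR hA lam K
      (Or.inr fun w hw => (hK w hw).1)
    refine ⟨a * c, by positivity, fun T hT hJ m w hw N hN => ?_⟩
    have hwd := vecMul_pow_eq_zero_of_le hw.vecMul_pow hw.le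
    rw [mainTerm, vecMul_theta_of_ne_one hq hT hJ h1 hw.vecMul_pow, smul_zero, add_zero,
      (hK w hwd).2 T hT hJ]
    refine ((hX w hwd N hN).trans (mul_le_mul_of_nonneg_left (hsum m w hw _) ha)).trans
      (le_of_eq ?_)
    ring

/-! ### From digit counts to powers of N, and uniform constants -/

theorem rate_eq_rpow_logb {R : ℝ} (hR : 0 < R) {N : ℕ} (hN : 1 ≤ N) :
    rate q R N = R ^ Real.logb q N := by
  have hN0 : (0 : ℝ) < N := by exact_mod_cast hN
  rw [rate, if_neg hR.ne', Real.rpow_def_of_pos hN0, Real.rpow_def_of_pos hR, Real.logb, Real.logb]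
  ring_nf

theorem rate_nonneg (q : ℕ) (R : ℝ) (N : ℕ) : 0 ≤ rate q R N := by
  rw [rate]
  split_ifs <;> positivity

/-- Rounding log_q N down changes R^(log_q N) by at most a factor R⁻¹, and only when R < 1. -/
theorem pow_log_le_rate (hq : 2 ≤ q) {R : ℝ} (hR : 0 < R) {N : ℕ} (hN : 1 ≤ N) :
    R ^ Nat.log q N ≤ (1 + R⁻¹) * rate q R N := by
  rw [rate_eq_rpow_logb hR hN]
  have hpos : 0 < R ^ Real.logb q N := Real.rpow_pos_of_pos hR _
  have hinv : 0 < R⁻¹ := inv_pos.mpr hR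
  rcases le_total 1 R with h | h
  · have := Real.rpow_le_rpow_of_exponent_le h (log_le_logb hq hN)
    rw [Real.rpow_natCast] at this
    nlinarith [mul_pos hinv hpos]
  · have := Real.rpow_le_rpow_of_exponent_ge hR h (logb_le_log_add_one hq hN)
    rw [Real.rpow_add_one hR.ne', Real.rpow_natCast] at this
    have h1 := mul_le_mul_of_nonneg_left this hinv.le
    rw [mul_comm (R ^ Nat.log q N), inv_mul_cancel_left₀ hR.ne'] at h1
    nlinarith

theorem log_add_one_pow_le (hq : 2 ≤ q) {N m : ℕ} (hN : q ≤ N) (hm : m ≤ d) :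
    ((Nat.log q N : ℝ) + 1) ^ m ≤ (1 + 2 / Real.log q) ^ d * Real.log N ^ m := by
  have hq1 : (1 : ℝ) < q := by exact_mod_cast (by omega : 1 < q)
  have hlq := Real.log_pos hq1
  have hlN : 0 ≤ Real.log N := Real.log_nonneg (by exact_mod_cast (by omega : 1 ≤ N))
  have h1 : (1 : ℝ) ≤ Nat.log q N := by
    exact_mod_cast Nat.log_pos (by omega) hN
  have h2 := log_le_logb hq (by omega : 1 ≤ N)
  have h3 : (Nat.log q N : ℝ) + 1 ≤ (1 + 2 / Real.log q) * Real.log N := by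
    rw [Real.logb] at h2
    calc (Nat.log q N : ℝ) + 1 ≤ 2 * (Real.log N / Real.log q) := by linarith
      _ = 2 / Real.log q * Real.log N := by ring
      _ ≤ _ := by gcongr; linarith
  refine (pow_le_pow_left₀ (by linarith) h3 m).trans ?_
  rw [mul_pow]
  gcongr
  have : 0 ≤ 2 / Real.log q := by positivity
  linarith

theorem eventually_vecMul_sumF_eq (hq : 2 ≤ q) (A : Fin q → Matrix (Fin d) (Fin d) ℂ)
    (hA : ProductsBounded A 0) :
    ∃ N₀ : ℕ, ∀ T : Matrix (Fin d) (Fin d) ℂ, IsUnit T → IsJordanForm (matJ A T) →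
      ∀ (m : ℕ) (w : Fin d → ℂ), IsGenLeftEigenvector (matC A) 0 m w → ∀ N, N₀ ≤ N →
      w ᵥ* sumF hq A N = mainTerm hq A T m w N := by
  obtain ⟨c, n₀, -, -, hF⟩ := hA.exists_norm_sumF_sub_le hq le_rfl
  obtain ⟨K, hK⟩ := exists_matK_independent hq A (zero_ne_one (α := ℂ))
  -- The threshold leaves d digits to strip off before ⌊log_q⌋ falls below n₀ + 1. Until then the
  -- one-step error bound carries a factor 0^⌊log_q N⌋ = 0, so the recursion is exact; after d steps
  -- w C^d = 0.
  refine ⟨q ^ (n₀ + 1 + d), fun T hT hJ m w hw N hN => ?_⟩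
  have hwd := vecMul_pow_eq_zero_of_le hw.vecMul_pow hw.le
  rw [mainTerm, vecMul_theta_of_ne_one hq hT hJ zero_ne_one hw.vecMul_pow, smul_zero, add_zero,
    (hK w hwd).2 T hT hJ, ← sub_eq_zero, ← vecMul_sub]
  have key : ∀ (k : ℕ) (w : Fin d → ℂ),
      w ᵥ* (matC A - (0 : ℂ) • (1 : Matrix (Fin d) (Fin d) ℂ)) ^ d = 0 → ∀ N,
      q ^ (n₀ + 1 + k) ≤ N →
      ∃ M, w ᵥ* (sumF hq A N - K) = (w ᵥ* matC A ^ k) ᵥ* (sumF hq A M - K) := by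
    intro k
    induction k with
    | zero => exact fun w _ N _ => ⟨N, by simp⟩
    | succ k ih =>
      intro w hw N hN
      obtain ⟨M, hM⟩ := ih (w ᵥ* matC A) (vecMul_mem_of_vecMul_sub_pow (Commute.refl _) hw) (N / q)
        ((Nat.le_div_iff_mul_le (by omega)).mpr (by rwa [← pow_succ]))
      refine ⟨M, ?_⟩
      rw [pow_succ', ← vecMul_vecMul, ← hM]
      have hl : n₀ + 1 ≤ Nat.log q N := Nat.le_log_of_pow_le (by omega)
        ((Nat.pow_le_pow_right (by omega) (by omega)).trans hN)
      have hqN : q ≤ N := (Nat.le_self_pow (by omega) q).trans hN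
      have h1 := hF N hqN (by omega) w
      rw [zero_pow (by omega), mul_zero, zero_mul, norm_le_zero_iff, sub_eq_zero] at h1
      rw [vecMul_sub, vecMul_sub, h1, (hK w hw).1]
      abel
  obtain ⟨M, hM⟩ := key d w hwd N hN
  rw [zero_smul, sub_zero] at hwd
  rw [hM, hwd, zero_vecMul]

theorem exists_error_bounds (hq : 2 ≤ q) (A : Fin q → Matrix (Fin d) (Fin d) ℂ) {R : ℝ}
    (hR : 0 ≤ R) (hA : ProductsBounded A R) (lam : ℂ) :
    ∃ (c : ℝ) (N₀ : ℕ), 0 ≤ c ∧ ∀ T : Matrix (Fin d) (Fin d) ℂ, IsUnit T →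
      IsJordanForm (matJ A T) →
      ∀ (m : ℕ) (w : Fin d → ℂ), IsGenLeftEigenvector (matC A) lam m w → ∀ N, N₀ ≤ N →
      (‖lam‖ < R → ‖w ᵥ* sumF hq A N - mainTerm hq A T m w N‖ ≤ c * ‖w‖ * rate q R N) ∧
      (‖lam‖ = R → ‖w ᵥ* sumF hq A N - mainTerm hq A T m w N‖ ≤
        c * ‖w‖ * (rate q R N * Real.log N ^ m)) := by
  rcases lt_trichotomy ‖lam‖ R with h | h | h
  · have hR0 : 0 < R := (norm_nonneg _).trans_lt h
    obtain ⟨c, hc, hb⟩ := exists_error_le_of_norm_lt hq A hR0 hA h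
    refine ⟨c * (1 + R⁻¹), 1, by positivity, fun T hT hJ m w hw N hN =>
      ⟨fun _ => ?_, fun h' => absurd h' h.ne⟩⟩
    calc _ ≤ c * R ^ Nat.log q N * ‖w‖ := hb T hT hJ m w hw N hN
      _ ≤ c * ((1 + R⁻¹) * rate q R N) * ‖w‖ := by gcongr; exact pow_log_le_rate hq hR0 hN
      _ = _ := by ring
  · rcases eq_or_lt_of_le hR with hR0 | hR0
    · subst hR0
      rw [norm_eq_zero] at h
      subst h
      obtain ⟨N₀, hb⟩ := eventually_vecMul_sumF_eq hq A hA
      refine ⟨0, N₀, le_rfl, fun T hT hJ m w hw N hN => ?_⟩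
      rw [hb T hT hJ m w hw N hN]
      simp
    · obtain ⟨c, hc, hb⟩ := exists_error_le_of_norm_eq hq A hR0 hA h
      have hlq : 0 ≤ 2 / Real.log q := by positivity
      refine ⟨c * (1 + R⁻¹) * (1 + 2 / Real.log q) ^ d, q, by positivity, fun T hT hJ m w hw N hN =>
        ⟨fun h' => absurd h h'.ne, fun _ => ?_⟩⟩
      have hrate := rate_nonneg q R N
      calc _ ≤ c * (R ^ Nat.log q N * ((Nat.log q N : ℝ) + 1) ^ m) * ‖w‖ :=
            hb T hT hJ m w hw N (by omega)
        _ ≤ c * (((1 + R⁻¹) * rate q R N) *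
            ((1 + 2 / Real.log q) ^ d * Real.log N ^ m)) * ‖w‖ := by
            gcongr
            · exact pow_log_le_rate hq hR0 (by omega)
            · exact log_add_one_pow_le hq hN hw.le
        _ = _ := by ring
  · exact ⟨0, 0, le_rfl, fun T hT hJ m w hw N hN =>
      ⟨fun h' => absurd h h'.not_gt, fun h' => absurd h' h.ne'⟩⟩

/-- Each eigenvalue has its own constant and threshold; summing over the finite spectrum dominates
all of them. -/
theorem exists_uniform_error_bounds (hq : 2 ≤ q) (A : Fin q → Matrix (Fin d) (Fin d) ℂ) {R : ℝ}
    (hR : 0 ≤ R) (hA : ProductsBounded A R) (ν : Seminorm ℂ (Fin d → ℂ))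
    (hν : ∀ x, ν x = 0 → x = 0) :
    ∃ (c : ℝ) (N₀ : ℕ), ∀ T : Matrix (Fin d) (Fin d) ℂ, IsUnit T →
      IsJordanForm (matJ A T) →
      ∀ (lam : ℂ) (m : ℕ) (w : Fin d → ℂ), IsGenLeftEigenvector (matC A) lam m w → ∀ N, N₀ ≤ N →
      (‖lam‖ < R → ν (w ᵥ* sumF hq A N - mainTerm hq A T m w N) ≤ c * ν w * rate q R N) ∧
      (‖lam‖ = R → ν (w ᵥ* sumF hq A N - mainTerm hq A T m w N) ≤
        c * ν w * (rate q R N * Real.log N ^ m)) := by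
  obtain ⟨b, hb, hle⟩ := exists_seminorm_le_norm ν
  obtain ⟨a, ha, hge⟩ := exists_norm_le_seminorm ν hν
  choose c N₀ hc hbd using exists_error_bounds hq A hR hA
  set S := (matC A).finite_spectrum.toFinset with hS
  refine ⟨b * (∑ lam ∈ S, c lam) * a, ∑ lam ∈ S, N₀ lam, fun T hT hJ lam m w hw N hN => ?_⟩
  have hmem : lam ∈ S := by
    rw [hS, Set.Finite.mem_toFinset]
    exact hw.mem_spectrum
  have hNle : N₀ lam ≤ N :=
    (Finset.single_le_sum (f := N₀) (fun _ _ => Nat.zero_le _) hmem).trans hN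
  have hcle : c lam ≤ ∑ lam ∈ S, c lam := Finset.single_le_sum (f := c) (fun l _ => hc l) hmem
  have hconv : ∀ {x : Fin d → ℂ} {r : ℝ}, 0 ≤ r → ‖x‖ ≤ c lam * ‖w‖ * r →
      ν x ≤ b * (∑ lam ∈ S, c lam) * a * ν w * r := by
    intro x r hr hx
    have hc0 := hc lam
    calc ν x ≤ b * (c lam * ‖w‖ * r) := (hle x).trans (by gcongr)
      _ ≤ b * ((∑ lam ∈ S, c lam) * (a * ν w) * r) := by
          gcongr
          · exact hc0.trans hcle
          · exact hge w
      _ = _ := by ring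
  obtain ⟨h1, h2⟩ := hbd lam T hT hJ m w hw N hNle
  have hrate := rate_nonneg q R N
  have hlog : 0 ≤ Real.log N := Real.log_natCast_nonneg N
  exact ⟨fun h => hconv hrate (h1 h), fun h => hconv (by positivity) (h2 h)⟩

/-! ### The periodic expansion: eigenvalues of modulus above R -/

/-- C^n is a sum of q^n products of size O(R^n), hence ‖lam‖^n ≤ c (qR)^n for large n, and n → ∞
removes c. It forces R > 0 when ‖lam‖ > R, and keeps the Hölder exponents below 1. -/
theorem ProductsBounded.norm_le_mul {A : Fin q → Matrix (Fin d) (Fin d) ℂ} {R : ℝ}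
    (hR : 0 ≤ R) (hA : ProductsBounded A R) {lam : ℂ} {v : Fin d → ℂ} (hv0 : v ≠ 0)
    (hv : v ᵥ* matC A = lam • v) : ‖lam‖ ≤ q * R := by
  obtain ⟨c, n₀, hc, -, hb⟩ := hA
  have h1 : ∀ (n : ℕ) (l : List (Fin q)), n₀ ≤ l.length + n →
      ‖(v ᵥ* (l.map A).prod) ᵥ* matC A ^ n‖ ≤ q ^ n * (c * R ^ (l.length + n) * ‖v‖) := by
    intro n
    induction n with
    | zero => intro l hl; simpa using hb l hl v
    | succ n ih =>
      intro l hl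
      rw [pow_succ', ← vecMul_vecMul, matC, vecMul_sum, ← matC, sum_vecMul]
      refine (norm_sum_le _ _).trans ?_
      have h2 : ∀ r ∈ Finset.univ, ‖((v ᵥ* (l.map A).prod) ᵥ* A r) ᵥ* matC A ^ n‖ ≤
          q ^ n * (c * R ^ (l.length + (n + 1)) * ‖v‖) := by
        intro r _
        have := ih (l ++ [r]) (by rw [List.length_append, List.length_singleton]; omega)
        rw [List.map_append, List.prod_append, ← vecMul_vecMul, List.length_append] at this
        simpa [add_assoc, add_comm 1 n] using this
      refine (Finset.sum_le_sum h2).trans (le_of_eq ?_)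
      rw [Finset.sum_const, Finset.card_univ, Fintype.card_fin, nsmul_eq_mul]
      ring
  have h2 : ∀ n, v ᵥ* matC A ^ n = lam ^ n • v := by
    intro n
    induction n with
    | zero => simp
    | succ n ih => rw [pow_succ, ← vecMul_vecMul, ih, smul_vecMul, hv, smul_smul, pow_succ]
  have hvpos : 0 < ‖v‖ := norm_pos_iff.mpr hv0
  have h3 : ∀ n, n₀ ≤ n → ‖lam‖ ^ n ≤ c * (q * R) ^ n := by
    intro n hn
    have := h1 n [] (by simpa using hn)
    rw [List.map_nil, List.prod_nil, vecMul_one, h2, norm_smul, norm_pow, List.length_nil,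
      zero_add, ← mul_assoc] at this
    have := le_of_mul_le_mul_right this hvpos
    rw [mul_pow]
    linarith
  by_contra! hlt
  have hpos : 0 < ‖lam‖ := lt_of_le_of_lt (by positivity) hlt
  have hlim : Tendsto (fun n : ℕ => c * (q * R / ‖lam‖) ^ n) atTop (𝓝 (c * 0)) :=
    (tendsto_pow_atTop_nhds_zero_of_lt_one (by positivity) (by rwa [div_lt_one hpos])).const_mul c
  rw [mul_zero] at hlim
  obtain ⟨n, hn1, hn2⟩ := ((hlim.eventually_lt_const one_pos).and (eventually_ge_atTop n₀)).exists
  have h4 := h3 n hn2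
  rw [div_pow, mul_div_assoc', div_lt_one (by positivity)] at hn1
  linarith

theorem cpowLog_eq (lam : ℂ) {N : ℕ} (hN : 1 ≤ N) :
    cpowLog q lam N = Complex.exp ((Real.logb q N : ℝ) * Complex.log lam) := by
  have hN0 : (N : ℂ) ≠ 0 := by exact_mod_cast (by omega : N ≠ 0)
  rw [cpowLog, Complex.cpow_def_of_ne_zero hN0, ← Complex.natCast_log, ← Complex.natCast_log,
    Real.logb]
  push_cast
  ring_nf

theorem vecMul_seqF_of_fixed (hq : 2 ≤ q) {A : Fin q → Matrix (Fin d) (Fin d) ℂ} {v : Fin d → ℂ}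
    (hv : ∀ r, v ᵥ* A r = v) (n : ℕ) : v ᵥ* seqF hq A n = v := by
  induction n using Nat.strong_induction_on with
  | _ n ih =>
    rw [seqF]
    split_ifs with h
    · rw [vecMul_one]
    · rw [← vecMul_vecMul, hv, ih _ (Nat.div_lt_self (by omega) (by omega))]

theorem vecMul_sumF_of_fixed (hq : 2 ≤ q) {A : Fin q → Matrix (Fin d) (Fin d) ℂ} {v : Fin d → ℂ}
    (hv : ∀ r, v ᵥ* A r = v) (N : ℕ) : v ᵥ* sumF hq A N = (N : ℂ) • v := by
  rw [sumF, vecMul_sum, Finset.sum_congr rfl fun n _ => vecMul_seqF_of_fixed hq hv n,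
    Finset.sum_const, Finset.card_range, Nat.cast_smul_eq_nsmul]

theorem vecMul_matC_of_fixed {A : Fin q → Matrix (Fin d) (Fin d) ℂ} {v : Fin d → ℂ}
    (hv : ∀ r, v ᵥ* A r = v) : v ᵥ* matC A = (q : ℂ) • v := by
  rw [matC, vecMul_sum, Finset.sum_congr rfl fun r _ => hv r, Finset.sum_const, Finset.card_univ,
    Fintype.card_fin, Nat.cast_smul_eq_nsmul]

/-- The rescaling factor is q^(-(u+j)), so the floor term tends to v and the constant y is damped
away. -/
theorem tendsto_rescaled_floor (hq : 2 ≤ q) (u : ℝ) (v y : Fin d → ℂ) :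
    Tendsto (fun j : ℕ => Complex.exp ((-(u + j) : ℝ) * Complex.log (q : ℂ)) •
      ((⌊(q : ℝ) ^ (u + j)⌋₊ : ℂ) • v - y)) atTop (𝓝 v) := by
  have hq1 : (1 : ℝ) < q := by exact_mod_cast (by omega : 1 < q)
  have hq0 : (0 : ℝ) < q := by linarith
  have hexp : ∀ t : ℝ, Complex.exp ((-t : ℝ) * Complex.log (q : ℂ)) = (((q : ℝ) ^ t)⁻¹ : ℝ) := by
    intro t
    rw [← Complex.natCast_log, ← Real.rpow_neg hq0.le, Real.rpow_def_of_pos hq0, mul_comm]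
    push_cast
    rfl
  have hlim : Tendsto (fun j : ℕ => (q : ℝ) ^ (u + j)) atTop atTop := by
    have h1 : (fun j : ℕ => (q : ℝ) ^ (u + j)) = fun j : ℕ => (q : ℝ) ^ u * (q : ℝ) ^ j := by
      funext j
      rw [Real.rpow_add hq0, Real.rpow_natCast]
    rw [h1]
    exact (tendsto_pow_atTop_atTop_of_one_lt hq1).const_mul_atTop (Real.rpow_pos_of_pos hq0 u)
  have h1 : Tendsto (fun j : ℕ => ((⌊(q : ℝ) ^ (u + j)⌋₊ / (q : ℝ) ^ (u + j) : ℝ) : ℂ)) atTop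
      (𝓝 ((1 : ℝ) : ℂ)) :=
    (Complex.continuous_ofReal.tendsto _).comp ((tendsto_nat_floor_div_atTop (R := ℝ)).comp hlim)
  have h2 : Tendsto (fun j : ℕ => ((((q : ℝ) ^ (u + j))⁻¹ : ℝ) : ℂ)) atTop (𝓝 ((0 : ℝ) : ℂ)) :=
    (Complex.continuous_ofReal.tendsto _).comp (tendsto_inv_atTop_zero.comp hlim)
  have h3 := (h1.smul_const v).sub (h2.smul_const y)
  rw [Complex.ofReal_one, one_smul, Complex.ofReal_zero, zero_smul, sub_zero] at h3
  refine h3.congr fun j => ?_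
  rw [hexp, smul_sub, smul_smul]
  push_cast
  rw [div_eq_inv_mul]

theorem lt_logb_div_iff (hq : 2 ≤ q) {R l : ℝ} (hR : 0 < R) (hl : 0 < l) (α : ℝ) :
    α < Real.logb q (l / R) ↔ R * (q : ℝ) ^ α < l := by
  have hq1 : (1 : ℝ) < q := by exact_mod_cast (by omega : 1 < q)
  rw [Real.lt_logb_iff_rpow_lt hq1 (by positivity), lt_div_iff₀ hR, mul_comm]

/-- The periodic expansion of a vector-valued sequence `x 0` that is completed by `x 1, …, x n` to a
solution of a Jordan-type recursion, with increments governed by the matrix products. -/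
theorem exists_periodic_expansion (hq : 2 ≤ q) {A : Fin q → Matrix (Fin d) (Fin d) ℂ} {R : ℝ}
    (hR : 0 < R) (hA : ProductsBounded A R) {lam : ℂ} (hlam : R < ‖lam‖) (n : ℕ)
    (W y : ℕ → Fin d → ℂ)
    (hx : ∀ k, ∀ N, 1 ≤ N → W k ᵥ* sumF hq A (q * N) + y k =
      lam • (W k ᵥ* sumF hq A N + y k) + (W (k + 1) ᵥ* sumF hq A N + y (k + 1)))
    (hW : W (n + 1) = 0) (hy : y (n + 1) = 0) :
    ∃ Φ : ℕ → ℝ → (Fin d → ℂ), (∀ k, Function.Periodic (Φ k) 1) ∧ (∀ k, Continuous (Φ k)) ∧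
      (∀ N, 1 ≤ N → W 0 ᵥ* sumF hq A N + y 0 = cpowLog q lam N •
        ∑ k ∈ Finset.range (n + 1), ((Real.logb q N : ℂ) ^ k) • Φ k (Int.fract (Real.logb q N))) ∧
      (∀ k, ∀ α : NNReal, 0 < α → (α : ℝ) ≤ 1 → (α : ℝ) < Real.logb q (‖lam‖ / R) →
        ∃ L : NNReal, HolderWith L α (Φ k)) ∧
      ∀ v, (∀ u : ℝ, Tendsto (fun j : ℕ => Complex.exp ((-(u + j) : ℝ) * Complex.log lam) •
          (W n ᵥ* sumF hq A ⌊(q : ℝ) ^ (u + j)⌋₊ + y n)) atTop (𝓝 v)) →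
        ∀ u, Φ n u = ((n.factorial : ℂ) * lam ^ n)⁻¹ • v := by
  obtain ⟨c, n₀, hc, hn₀, hf⟩ := hA.exists_norm_seqF_le hq hR.le
  rw [hn₀ hR] at hf
  obtain ⟨Φ, hper, hcont, hexp, hhol, htop⟩ := exists_shift_expansion hq hR hlam n
    (fun k N => W k ᵥ* sumF hq A N + y k) (fun k _ N hN => hx k N hN)
    (fun N => by simp only [hW, hy, zero_vecMul, add_zero])
    ⟨c * ∑ k ∈ Finset.range (n + 1), ‖W k‖, by positivity, fun k hk N hN => by
      rw [add_sub_add_right_eq_sub, sumF_succ, vecMul_add, add_sub_cancel_left, mul_right_comm]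
      refine (hf N hN (Nat.zero_le _) _).trans ?_
      gcongr
      exact Finset.single_le_sum (f := fun k => ‖W k‖) (fun _ _ => norm_nonneg _)
        (Finset.mem_range.mpr (by omega))⟩
  have hfract : ∀ k u, Φ k (Int.fract u) = Φ k u := fun k u => by
    have := (hper k).sub_int_mul_eq ⌊u⌋ (x := u)
    rwa [mul_one] at this
  refine ⟨Φ, hper, hcont, fun N hN => ?_, fun k α h0 h1 h2 => ?_, fun v hv u => ?_⟩
  · rw [cpowLog_eq lam hN]
    simp_rw [hfract]
    exact hexp N hN
  · exact hhol k α h0 h1 ((lt_logb_div_iff hq hR (hR.trans hlam) _).mp h2)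
  · rw [← hfract]
    exact htop _ v (Int.fract_nonneg u) (hv _)

theorem exists_expansion_of_lt_norm (hq : 2 ≤ q) {A : Fin q → Matrix (Fin d) (Fin d) ℂ} {R : ℝ}
    (hR : 0 ≤ R) (hA : ProductsBounded A R) {T : Matrix (Fin d) (Fin d) ℂ} (hT : IsUnit T)
    (hJ : IsJordanForm (matJ A T)) {lam : ℂ} {m : ℕ} {w : Fin d → ℂ}
    (hw : IsGenLeftEigenvector (matC A) lam m w) (hlam : R < ‖lam‖) :
    ∃ Φ : ℕ → ℝ → (Fin d → ℂ),
      (∀ k < m, Function.Periodic (Φ k) 1 ∧ Continuous (Φ k)) ∧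
      (∀ N : ℕ, q ^ (m - 1) ≤ N →
        w ᵥ* sumF hq A N = mainTerm hq A T m w N +
          cpowLog q lam N • ∑ k ∈ Finset.range m,
            ((Real.logb q N : ℂ) ^ k) • Φ k (Int.fract (Real.logb q N))) ∧
      (∀ k < m, ∀ α : NNReal, 0 < α → (α : ℝ) < Real.logb q (‖lam‖ / R) →
        ∃ L : NNReal, HolderWith L α (Φ k)) ∧
      ((∀ r : Fin q,
          (w ᵥ* (matC A - lam • (1 : Matrix (Fin d) (Fin d) ℂ)) ^ (m - 1)) ᵥ* A r =
            w ᵥ* (matC A - lam • (1 : Matrix (Fin d) (Fin d) ℂ)) ^ (m - 1)) →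
        ∀ u : ℝ, Φ (m - 1) u =
          ((q : ℂ) ^ (m - 1) * ((m - 1).factorial : ℂ))⁻¹ •
            (w ᵥ* (matC A - (q : ℂ) • (1 : Matrix (Fin d) (Fin d) ℂ)) ^ (m - 1))) := by
  have hq1 : (1 : ℝ) < q := by exact_mod_cast (by omega : 1 < q)
  have hv0 := hw.vecMul_pow_pred
  have hvC := hw.vecMul_pow_pred_vecMul
  have hle := hA.norm_le_mul hR hv0 hvC
  have hR0 : 0 < R := by
    rcases eq_or_lt_of_le hR with h | h
    · rw [← h] at hlam hle
      rw [mul_zero] at hle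
      exact absurd hlam hle.not_gt
    · exact h
  have hα1 : ∀ α : NNReal, (α : ℝ) < Real.logb q (‖lam‖ / R) → (α : ℝ) ≤ 1 := by
    intro α hα
    rw [lt_logb_div_iff hq hR0 (hR0.trans hlam)] at hα
    have h1 : (q : ℝ) ^ (α : ℝ) < (q : ℝ) ^ (1 : ℝ) := by
      rw [Real.rpow_one]
      have := hα.trans_le hle
      rw [mul_comm] at this
      exact lt_of_mul_lt_mul_right this hR
    exact ((Real.rpow_lt_rpow_left_iff hq1).mp h1).le
  have hfix : (∀ r : Fin q,
      (w ᵥ* (matC A - lam • (1 : Matrix (Fin d) (Fin d) ℂ)) ^ (m - 1)) ᵥ* A r =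
        w ᵥ* (matC A - lam • (1 : Matrix (Fin d) (Fin d) ℂ)) ^ (m - 1)) → lam = q := by
    intro h
    have h1 := vecMul_matC_of_fixed h
    rw [hvC] at h1
    exact smul_left_injective ℂ hv0 h1
  set V : ℕ → Fin d → ℂ :=
    fun k => w ᵥ* (matC A - lam • (1 : Matrix (Fin d) (Fin d) ℂ)) ^ k with hV
  have hVC : ∀ k, V k ᵥ* matC A = lam • V k + V (k + 1) := by
    intro k
    simp only [hV]
    rw [pow_succ, ← vecMul_vecMul, vecMul_sub, vecMul_smul, vecMul_one]
    abel
  have hVmem : ∀ k, V k ᵥ* (matC A - lam • (1 : Matrix (Fin d) (Fin d) ℂ)) ^ m = 0 := by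
    intro k
    simp only [hV]
    rw [vecMul_vecMul, ← pow_add]
    exact vecMul_pow_eq_zero_of_le hw.vecMul_pow (by omega)
  have hV0 : V 0 = w := by simp [hV]
  have hVm : V m = 0 := hw.vecMul_pow
  have hpow1 : ∀ {N : ℕ}, q ^ (m - 1) ≤ N → 1 ≤ N := fun h =>
    (Nat.one_le_pow _ _ (by omega)).trans h
  by_cases h1 : lam = 1
  -- For lam = 1 the chain is lengthened by one: y_(k+1) = V_k(1 - A_0) carries the inhomogeneity,
  -- so the last index is m instead of m - 1.
  · set y : ℕ → Fin d → ℂ := fun k => if k = 0 then 0 else V (k - 1) ᵥ* (1 - matA0 hq A) with hy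
    obtain ⟨Φ, hper, hcont, hexp, hhol, htop⟩ := exists_periodic_expansion hq hR0 hA hlam m V y
      (fun k N hN => by
        have e : y (k + 1) = V k ᵥ* (1 - matA0 hq A) := by simp [hy]
        rw [sumF_mul hq A hN, e, vecMul_add, ← vecMul_vecMul, hVC, h1, one_smul, one_smul,
          add_vecMul]
        abel)
      (by rw [hV]; exact vecMul_pow_eq_zero_of_le hw.vecMul_pow (by omega)) (by simp [hy, hVm])
    -- As V_m = 0 and lam = 1, the last coordinate is the constant V_(m-1)(1 - A_0). Dividing by m!
    -- gives wϑ_m, and the term k = m of the expansion becomes the explicit logarithmic term.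
    have hΦm : ∀ u, Φ m u = w ᵥ* theta hq A T m := by
      intro u
      have hwm := hw.vecMul_pow
      rw [htop (y m) (fun u => by simp [h1, hVm]) u, h1, one_pow, mul_one]
      rw [h1, one_smul] at hwm
      rw [vecMul_theta_of_eq_one hq hT hJ hwm]
      simp only [hy, hV, h1, one_smul]
      rw [if_neg (by have := hw.one_le; omega), vecMul_vecMul]
    refine ⟨Φ, fun k _ => ⟨hper k, hcont k⟩, fun N hN => ?_,
      fun k _ α h0 h => hhol k α h0 (hα1 α h) h, fun h => ?_⟩
    · have hwm := hw.vecMul_pow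
      rw [h1, one_smul] at hwm
      have h2 := hexp N (hpow1 hN)
      have hy0 : y 0 = 0 := by simp [hy]
      have hc1 : cpowLog q lam N = 1 := by simp [cpowLog, h1]
      rw [hV0, hy0, add_zero, hc1, one_smul, Finset.sum_range_succ, hΦm] at h2
      rw [mainTerm, vecMul_matK_of_eq_one hq hT hJ hwm, zero_add, hc1, one_smul, h2, add_comm]
    -- Common fixed vectors belong to the eigenvalue q ≥ 2, so the hypothesis of the constancy claim
    -- cannot hold here.
    · have := hfix h
      rw [h1] at this
      exact absurd this (by exact_mod_cast (by omega : (1 : ℕ) ≠ q))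
  · have hm : m - 1 + 1 = m := Nat.sub_add_cancel hw.one_le
    -- The shift by -V_k K cancels the inhomogeneity in every member of the chain, without
    -- lengthening it.
    obtain ⟨Φ, hper, hcont, hexp, hhol, htop⟩ := exists_periodic_expansion hq hR0 hA hlam (m - 1) V
      (fun k => -(V k ᵥ* matK hq A T))
      (fun k N hN => by
        have e := vecMul_matK_of_ne_one hq hT hJ h1 (hVmem k)
        rw [hVC, add_vecMul, smul_vecMul] at e
        rw [sumF_mul hq A hN, vecMul_add, ← vecMul_vecMul, hVC, add_vecMul, smul_vecMul,
          eq_sub_of_add_eq' e.symm]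
        module)
      (by rw [hm, hVm]) (by rw [hm, hVm, zero_vecMul, neg_zero])
    rw [hm] at hexp
    refine ⟨Φ, fun k _ => ⟨hper k, hcont k⟩, fun N hN => ?_,
      fun k _ α h0 h => hhol k α h0 (hα1 α h) h, fun h u => ?_⟩
    · have h2 := hexp N (hpow1 hN)
      rw [hV0] at h2
      rw [mainTerm, vecMul_theta_of_ne_one hq hT hJ h1 hw.vecMul_pow, smul_zero, add_zero, ← h2]
      abel
    · have hlq := hfix h
      have hVq : w ᵥ* (matC A - (q : ℂ) • (1 : Matrix (Fin d) (Fin d) ℂ)) ^ (m - 1) = V (m - 1) := by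
        simp only [hV, hlq]
      rw [hVq, mul_comm, htop (V (m - 1)) (fun u => ?_) u, hlq]
      -- A common fixed vector v satisfies v F(N) = N v, so the last coordinate of Ψ is the limit v
      -- itself.
      have hs : ∀ N, V (m - 1) ᵥ* sumF hq A N = (N : ℂ) • V (m - 1) :=
        vecMul_sumF_of_fixed hq h
      simp_rw [hs, hlq, ← sub_eq_add_neg]
      exact tendsto_rescaled_floor hq u (V (m - 1)) (V (m - 1) ᵥ* matK hq A T)

end MatrixProducts

end

open MatrixProducts in
theorem theorem5p1 {q d : ℕ} (hq : 2 ≤ q) (hd : 1 ≤ d)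
    (A : Fin q → Matrix (Fin d) (Fin d) ℂ)
    (ν : Seminorm ℂ (Fin d → ℂ)) (hν : ∀ x, ν x = 0 → x = 0)
    (R : ℝ) (hR : IsAdmissibleRadius ν A R) :
    ∃ (c : ℝ) (N₀ : ℕ),
      ∀ T : Matrix (Fin d) (Fin d) ℂ, IsUnit T → IsJordanForm (matJ A T) →
      ∀ (lam : ℂ) (m : ℕ) (w : Fin d → ℂ), IsGenLeftEigenvector (matC A) lam m w →
        (‖lam‖ < R → ∀ N : ℕ, N₀ ≤ N →
          ν (w ᵥ* sumF hq A N - mainTerm hq A T m w N) ≤ c * ν w * rate q R N) ∧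
        (‖lam‖ = R → ∀ N : ℕ, N₀ ≤ N →
          ν (w ᵥ* sumF hq A N - mainTerm hq A T m w N)
            ≤ c * ν w * (rate q R N * Real.log N ^ m)) ∧
        (R < ‖lam‖ → ∃ Φ : ℕ → ℝ → (Fin d → ℂ),
          (∀ k < m, Function.Periodic (Φ k) 1 ∧ Continuous (Φ k)) ∧
          (∀ N : ℕ, q ^ (m - 1) ≤ N →
            w ᵥ* sumF hq A N = mainTerm hq A T m w N +
              cpowLog q lam N • ∑ k ∈ Finset.range m,
                ((Real.logb q N : ℂ) ^ k) • Φ k (Int.fract (Real.logb q N))) ∧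
          (∀ k < m, ∀ α : NNReal, 0 < α → (α : ℝ) < Real.logb q (‖lam‖ / R) →
            ∃ L : NNReal, HolderWith L α (Φ k)) ∧
          ((∀ r : Fin q,
              (w ᵥ* (matC A - lam • (1 : Matrix (Fin d) (Fin d) ℂ)) ^ (m - 1)) ᵥ* A r =
                w ᵥ* (matC A - lam • (1 : Matrix (Fin d) (Fin d) ℂ)) ^ (m - 1)) →
            ∀ u : ℝ, Φ (m - 1) u =
              ((q : ℂ) ^ (m - 1) * ((m - 1).factorial : ℂ))⁻¹ •
                (w ᵥ* (matC A - (q : ℂ) • (1 : Matrix (Fin d) (Fin d) ℂ)) ^ (m - 1)))) ∧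
        (lam = 1 → w ᵥ* matK hq A T = 0) ∧
        (lam ≠ 1 → w ᵥ* theta hq A T m = 0) := by

  obtain ⟨hR0, hA⟩ := productsBounded_of_isAdmissibleRadius ν hν A hR
  obtain ⟨c, N₀, hb⟩ := exists_uniform_error_bounds hq A hR0 hA ν hν
  refine ⟨c, N₀, fun T hT hJ lam m w hw =>
    ⟨fun h N hN => (hb T hT hJ lam m w hw N hN).1 h, fun h N hN => (hb T hT hJ lam m w hw N hN).2 h,
      fun h => exists_expansion_of_lt_norm hq hR0 hA hT hJ hw h, fun h => ?_,
      fun h => vecMul_theta_of_ne_one hq hT hJ h hw.vecMul_pow⟩⟩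
  have hwm := hw.vecMul_pow
  rw [h, one_smul] at hwm
  exact vecMul_matK_of_eq_one hq hT hJ hwm
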